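/- Let $\omega\subset\mathbb{R}^d$ be an open, bounded, contractible domain with Lipschitz boundary, and let $A=[A_{ij}]_{i,j=1}^d\in L^2(\omega,\mathbb{R}^{d\times d}_{\mathrm{sym}})$ be a field of symmetric matrices. Define, for all $i,j,s,t\in\{1,\dots,d\}$, the distributions on $\omega$ $$\mathfrak{C}^2(A)_{ij,st}=\partial_i\partial_sA_{jt}+\partial_j\partial_tA_{is}-\partial_i\partial_tA_{js}-\partial_j\partial_sA_{it}.$$ Then the following two conditions are equivalent: (i) there exists $w\in H^1(\omega,\mathbb{R}^d)$ such that $A=\mathrm{sym}\nabla w=\tfrac12\big(\nabla w+(\nabla w)^T\big)$ almost everywhere in $\omega$; (ii) $\mathfrak{C}^2(A)_{ij,st}=0$ in the sense of distributions on $\omega$, for all $i,j,s,t\in\{1,\dots,d\}$. -/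

import Mathlib

open MeasureTheory TopologicalSpace
open scoped Distributions LineDeriv RealInnerProductSpace

noncomputable section

namespace SaintVenant

variable {d : ℕ}

/-- `Ω` has Lipschitz boundary: near each boundary point, in suitable orthonormal coordinates
(with last axis along the unit vector `ν`), `Ω` is the strict epigraph of a Lipschitz function
`γ` of the remaining coordinates. -/
def HasLipschitzBoundary (Ω : Set (EuclideanSpace ℝ (Fin d))) : Prop :=
  ∀ x ∈ frontier Ω, ∃ r > 0, ∃ ν : EuclideanSpace ℝ (Fin d), ‖ν‖ = 1 ∧
    ∃ (K : NNReal) (γ : (Submodule.span ℝ {ν})ᗮ → ℝ), LipschitzWith K γ ∧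
      ∀ y ∈ Metric.ball x r,
        y ∈ Ω ↔ γ ((Submodule.span ℝ {ν})ᗮ.orthogonalProjectionOnto y) < ⟪ν, y⟫

/-- The (regular) distribution `φ ↦ ∫ φ f` on `Ω` defined by a function `f` that is locally
integrable on `Ω`. -/
def toDistribution (Ω : Opens (EuclideanSpace ℝ (Fin d))) (f : EuclideanSpace ℝ (Fin d) → ℝ) :
    𝓓'(Ω, ℝ) :=
  (TestFunction.integralAgainstBilinCLM (ContinuousLinearMap.mul ℝ ℝ) volume f :
    𝓓(Ω, ℝ) →L[ℝ] ℝ)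

/-- The partial derivative `∂ᵢ T` of a distribution `T` on `Ω`. -/
def partialDeriv {Ω : Opens (EuclideanSpace ℝ (Fin d))} (i : Fin d) (T : 𝓓'(Ω, ℝ)) : 𝓓'(Ω, ℝ) :=
  ∂_{EuclideanSpace.single i (1 : ℝ)} T

/-- `L²(Ω, ℝ^{d × d})`. -/
def MemL2Matrix (Ω : Opens (EuclideanSpace ℝ (Fin d)))
    (A : EuclideanSpace ℝ (Fin d) → Matrix (Fin d) (Fin d) ℝ) : Prop :=
  ∀ i j, MemLp (fun x => A x i j) 2 (volume.restrict (Ω : Set (EuclideanSpace ℝ (Fin d))))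

/-- `G` is the weak gradient of the vector field `w` on `Ω`: both are locally integrable and
`∂ⱼ wⁱ = Gᵢⱼ` in the sense of distributions on `Ω`. -/
def HasWeakGradient (Ω : Opens (EuclideanSpace ℝ (Fin d)))
    (w : EuclideanSpace ℝ (Fin d) → EuclideanSpace ℝ (Fin d))
    (G : EuclideanSpace ℝ (Fin d) → Matrix (Fin d) (Fin d) ℝ) : Prop :=
  ∀ i j, LocallyIntegrableOn (fun x => w x i) (Ω : Set (EuclideanSpace ℝ (Fin d))) volume ∧
    LocallyIntegrableOn (fun x => G x i j) (Ω : Set (EuclideanSpace ℝ (Fin d))) volume ∧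
    partialDeriv j (toDistribution Ω fun x => w x i) = toDistribution Ω fun x => G x i j

/-- `H¹(Ω, ℝ^d)`: square integrable vector fields with square integrable weak gradient. -/
def MemH1 (Ω : Opens (EuclideanSpace ℝ (Fin d)))
    (w : EuclideanSpace ℝ (Fin d) → EuclideanSpace ℝ (Fin d)) : Prop :=
  MemLp w 2 (volume.restrict (Ω : Set (EuclideanSpace ℝ (Fin d)))) ∧
    ∃ G, HasWeakGradient Ω w G ∧ MemL2Matrix Ω G

/-- `A = sym ∇w` almost everywhere on `Ω`, where `sym G = (G + Gᵀ) / 2`. -/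
def IsSymGradient (Ω : Opens (EuclideanSpace ℝ (Fin d)))
    (w : EuclideanSpace ℝ (Fin d) → EuclideanSpace ℝ (Fin d))
    (A : EuclideanSpace ℝ (Fin d) → Matrix (Fin d) (Fin d) ℝ) : Prop :=
  ∃ G, HasWeakGradient Ω w G ∧
    ∀ᵐ x ∂(volume.restrict (Ω : Set (EuclideanSpace ℝ (Fin d)))),
      A x = (1 / 2 : ℝ) • (G x + (G x).transpose)

/-- The component `∂ᵢ∂ₛ Aⱼₜ + ∂ⱼ∂ₜ Aᵢₛ - ∂ᵢ∂ₜ Aⱼₛ - ∂ⱼ∂ₛ Aᵢₜ` of the operator `ℭ²` applied to a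
matrix field `A`, as a distribution on `Ω`. -/
def opC2 (Ω : Opens (EuclideanSpace ℝ (Fin d)))
    (A : EuclideanSpace ℝ (Fin d) → Matrix (Fin d) (Fin d) ℝ) (i j s t : Fin d) : 𝓓'(Ω, ℝ) :=
  partialDeriv i (partialDeriv s (toDistribution Ω fun x => A x j t))
    + partialDeriv j (partialDeriv t (toDistribution Ω fun x => A x i s))
    - partialDeriv i (partialDeriv t (toDistribution Ω fun x => A x j s))
    - partialDeriv j (partialDeriv s (toDistribution Ω fun x => A x i t))

end SaintVenant

end

/-!
A symmetrised gradient is compatible because partial derivatives of distributions commute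
(`opC2_eq_zero_of_isSymGradient`). The converse applies twice a Poincaré lemma with low regularity,
`exists_primitive`: on a bounded simply connected Lipschitz domain, a curl-free family of
distributions `Tₖ = gₖ + ∑ₗ ∂ₗ Fₖₗ` with `gₖ`, `Fₖₗ` in `L²` is the gradient of a function in `L²`.
For fixed `i`, `j`, the compatibility conditions say that `Tₖ = ∂ⱼ Aᵢₖ - ∂ᵢ Aⱼₖ` is curl-free; its
potentials `qᵢⱼ` form the skew-symmetric part of the gradient to be found (`exists_rotation`). The
rows of `A + q` are then curl-free fields in `L²`, and their potentials are the components of the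
displacement (`exists_displacement`).

The local part of the Poincaré lemma rests on an averaged homotopy operator. For a mollifier `φ`,
put `Rₘ ψ (x) = ∫₀¹ ∫ zₘ φ(z) ψ(x - s z) dz ds`. Then `∑ₘ ∂ₘ Rₘ ψ = ψ - φ * ψ`
(`sum_pderiv_homotopyOp`), and `Rₘ` gains one derivative in `L²`: its Fourier multiplier is the
integral over `s ∈ [0, 1]` of the values at `s ξ` of a rapidly decreasing function, hence
`O(1 / ‖ξ‖)`, and Plancherel's theorem applies (`exists_integral_sq_fderiv_radialAverage_le`).
Therefore `ψ ↦ -∑ₘ Tₘ(Rₘ ψ)` is bounded in `L²` and is given by some `q` in `L²`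
(`exists_memLp_homotopy`), and since `T` is curl-free, `∂ₖ q` differs from `Tₖ` by a smooth
curl-free field, which has a primitive by the classical Poincaré lemma on a ball. Only translates
of the support of `ψ` along the segments from the origin to the support of `φ` are involved, so all
this works up to the boundary when these segments point into the domain; near a boundary point of a
Lipschitz domain such a cone of directions exists (`exists_isPatch`).

Finitely many local primitives cover the domain. On overlaps they differ by locally constant
functions, which form a Čech cocycle; it is a coboundary because a covering of a simply connected
space has a section (`exists_coboundary`). Correcting the local primitives accordingly makes them
fit together, and the corrections are bounded, as a locally constant function on a patch is
determined by its values on a relatively compact translate of the patch (`IsPatch.exists_bound`).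
-/

noncomputable section

namespace SaintVenant

/-! ### Averages of translates -/

section TranslationAverage

open scoped ContDiff Pointwise FourierTransform

universe u

variable {E F : Type*} [NormedAddCommGroup E] [NormedAddCommGroup F] [NormedSpace ℝ F]
  {α : Type*} [MeasurableSpace α] {μ : Measure α} {w : α → ℝ} {θ : α → E}

/-- The weighted average `x ↦ ∫ w(a) f(x - θ(a)) dμ(a)` of translates of `f`, that is, the
convolution of `f` with the image of the signed measure `w μ` under `θ`. -/
def translationAverage (μ : Measure α) (w : α → ℝ) (θ : α → E) (f : E → F) (x : E) : F :=
  ∫ a, w a • f (x - θ a) ∂μ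

theorem tsupport_translationAverage_subset {f : E → F} (hfc : HasCompactSupport f) {K : Set E}
    (hK : IsCompact K) (hwK : ∀ a, w a ≠ 0 → θ a ∈ K) :
    tsupport (translationAverage μ w θ f) ⊆ tsupport f + K := by
  refine closure_minimal (fun x hx => ?_) (IsCompact.add hfc hK).isClosed
  by_contra hcon
  refine hx (integral_eq_zero_of_ae (Filter.Eventually.of_forall fun a => ?_))
  by_cases ha : w a = 0
  · simp [ha]
  · have : f (x - θ a) = 0 := by
      by_contra hne
      exact hcon ⟨x - θ a, subset_tsupport _ hne, θ a, hwK a ha, by simp⟩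
    simp [this]

theorem hasCompactSupport_translationAverage {f : E → F} (hfc : HasCompactSupport f) {K : Set E}
    (hK : IsCompact K) (hwK : ∀ a, w a ≠ 0 → θ a ∈ K) :
    HasCompactSupport (translationAverage μ w θ f) :=
  (IsCompact.add hfc hK).of_isClosed_subset (isClosed_tsupport _)
    (tsupport_translationAverage_subset hfc hK hwK)

variable [InnerProductSpace ℝ E]

/-- The Fourier multiplier `ξ ↦ ∫ exp(-2πi ⟪θ(a), ξ⟫) w(a) dμ(a)` of `translationAverage μ w θ`. -/
def translationMultiplier (μ : Measure α) (w : α → ℝ) (θ : α → E) (ξ : E) : ℂ :=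
  ∫ a, ((Real.fourierChar (-⟪θ a, ξ⟫) : Circle) : ℂ) * (w a : ℂ) ∂μ

theorem norm_translationMultiplier_le (ξ : E) :
    ‖translationMultiplier μ w θ ξ‖ ≤ ∫ a, ‖w a‖ ∂μ :=
  (norm_integral_le_integral_norm _).trans_eq (by simp [Circle.norm_coe])

variable [FiniteDimensional ℝ E] [MeasurableSpace E] [BorelSpace E]

theorem integrable_translate (hw : Integrable w μ) (hθ : Measurable θ) {f : E → F}
    (hf : Continuous f) (hfc : HasCompactSupport f) (x : E) :
    Integrable (fun a => w a • f (x - θ a)) μ := by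
  obtain ⟨C, hC⟩ := hfc.exists_bound_of_continuous hf
  have hm : AEStronglyMeasurable (fun a => f (x - θ a)) μ := by
    refine (hf.stronglyMeasurable_of_hasCompactSupport hfc).comp_measurable ?_
      |>.aestronglyMeasurable
    exact measurable_const.sub hθ
  exact hw.smul_bdd C hm (Filter.Eventually.of_forall fun a => hC _)

theorem hasFDerivAt_translationAverage (hw : Integrable w μ) (hθ : Measurable θ) {f : E → F}
    (hf : ContDiff ℝ 1 f) (hfc : HasCompactSupport f) (x : E) :
    HasFDerivAt (translationAverage μ w θ f) (translationAverage μ w θ (fderiv ℝ f) x) x := by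
  have hfc' : HasCompactSupport (fderiv ℝ f) := hfc.fderiv (𝕜 := ℝ)
  have hf' : Continuous (fderiv ℝ f) := hf.continuous_fderiv one_ne_zero
  obtain ⟨C, hC⟩ := hfc'.exists_bound_of_continuous hf'
  refine hasFDerivAt_integral_of_dominated_of_fderiv_le (𝕜 := ℝ) (s := Set.univ)
    (F := fun y a => w a • f (y - θ a)) (F' := fun y a => w a • fderiv ℝ f (y - θ a))
    (bound := fun a => ‖w a‖ * C) Filter.univ_mem ?_ ?_ ?_ ?_ ?_ ?_
  · exact Filter.Eventually.of_forall fun y =>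
      (integrable_translate hw hθ hf.continuous hfc y).aestronglyMeasurable
  · exact integrable_translate hw hθ hf.continuous hfc x
  · exact (integrable_translate hw hθ hf' hfc' x).aestronglyMeasurable
  · refine Filter.Eventually.of_forall fun a y _ => ?_
    rw [norm_smul]
    exact mul_le_mul_of_nonneg_left (hC _) (norm_nonneg _)
  · exact hw.norm.mul_const C
  · refine Filter.Eventually.of_forall fun a y _ => ?_
    have h1 : HasFDerivAt f (fderiv ℝ f (y - θ a)) (y - θ a) :=
      (hf.differentiable one_ne_zero _).hasFDerivAt
    have h2 : HasFDerivAt (fun y => y - θ a) (ContinuousLinearMap.id ℝ E) y :=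
      (hasFDerivAt_id y).sub_const _
    have h3 : HasFDerivAt (fun y => f (y - θ a)) (fderiv ℝ f (y - θ a)) y := by
      simpa [Function.comp_def] using h1.comp y h2
    exact h3.const_smul (w a)

/-- The induction replaces `F` by `E →L[ℝ] F`, hence the common universe of `E` and `F`. -/
theorem contDiff_nat_translationAverage {E F : Type u} [NormedAddCommGroup E]
    [InnerProductSpace ℝ E] [FiniteDimensional ℝ E] [MeasurableSpace E] [BorelSpace E]
    [NormedAddCommGroup F] [NormedSpace ℝ F] {θ : α → E} (hw : Integrable w μ) (hθ : Measurable θ)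
    (n : ℕ) {f : E → F} (hf : ContDiff ℝ ∞ f) (hfc : HasCompactSupport f) :
    ContDiff ℝ n (translationAverage μ w θ f) := by
  induction n generalizing F with
  | zero =>
    refine contDiff_zero.2 (continuous_iff_continuousAt.2 fun x => ?_)
    exact (hasFDerivAt_translationAverage hw hθ (hf.of_le (by simp)) hfc x).continuousAt
  | succ n ih =>
    have hd := hasFDerivAt_translationAverage hw hθ (hf.of_le (by simp)) hfc
    push_cast
    refine contDiff_succ_iff_fderiv.2 ⟨fun x => (hd x).differentiableAt, by simp, ?_⟩
    have : fderiv ℝ (translationAverage μ w θ f) = translationAverage μ w θ (fderiv ℝ f) :=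
      funext fun x => (hd x).fderiv
    rw [this]
    exact ih (hf.fderiv_right (by simp)) (hfc.fderiv (𝕜 := ℝ))

theorem contDiff_translationAverage {E F : Type u} [NormedAddCommGroup E]
    [InnerProductSpace ℝ E] [FiniteDimensional ℝ E] [MeasurableSpace E] [BorelSpace E]
    [NormedAddCommGroup F] [NormedSpace ℝ F] {θ : α → E} (hw : Integrable w μ) (hθ : Measurable θ)
    {f : E → F} (hf : ContDiff ℝ ∞ f) (hfc : HasCompactSupport f) :
    ContDiff ℝ ∞ (translationAverage μ w θ f) :=
  contDiff_infty.2 fun n => contDiff_nat_translationAverage hw hθ n hf hfc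

theorem fderiv_translationAverage_apply [CompleteSpace F] (hw : Integrable w μ)
    (hθ : Measurable θ) {f : E → F}
    (hf : ContDiff ℝ 1 f) (hfc : HasCompactSupport f) (x v : E) :
    fderiv ℝ (translationAverage μ w θ f) x v =
      translationAverage μ w θ (fun y => fderiv ℝ f y v) x := by
  rw [(hasFDerivAt_translationAverage hw hθ hf hfc x).fderiv, translationAverage,
    ContinuousLinearMap.integral_apply]
  · rfl
  · exact integrable_translate hw hθ (hf.continuous_fderiv one_ne_zero) (hfc.fderiv (𝕜 := ℝ)) x

/-- Fubini's theorem, in the variables `(a, x - θ a)`: the shear `(a, x) ↦ (a, x - θ a)` preserves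
the product measure. -/
theorem fourier_translationAverage [SFinite μ] (hw : Integrable w μ) (hθ : Measurable θ)
    {f : E → ℂ} (hf : Integrable f) (ξ : E) :
    𝓕 (translationAverage μ w θ f) ξ = translationMultiplier μ w θ ξ * 𝓕 f ξ := by
  have hmp : MeasurePreserving (fun p : α × E => (p.1, p.2 - θ p.1)) (μ.prod volume)
      (μ.prod volume) := by
    refine (MeasurePreserving.id μ).skew_product (g := fun a x => x - θ a) ?_ ?_
    · exact measurable_snd.sub (hθ.comp measurable_fst)
    · exact Filter.Eventually.of_forall fun a => (measurePreserving_sub_right volume (θ a)).map_eq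
  have hint : Integrable (fun p : α × E => (w p.1 : ℂ) * f (p.2 - θ p.1)) (μ.prod volume) :=
    hmp.integrable_comp_of_integrable (hw.ofReal.mul_prod hf)
  have hint2 : Integrable (fun p : α × E => ((Real.fourierChar (-⟪p.2, ξ⟫) : Circle) : ℂ) *
      ((w p.1 : ℂ) * f (p.2 - θ p.1))) (μ.prod volume) := by
    refine hint.bdd_mul (c := 1) ?_
      (Filter.Eventually.of_forall fun p => (Circle.norm_coe _).le)
    have hc : Continuous fun x : E => ((Real.fourierChar (-⟪x, ξ⟫) : Circle) : ℂ) :=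
      continuous_subtype_val.comp (Real.continuous_fourierChar.comp (by fun_prop))
    exact (hc.measurable.comp measurable_snd).aestronglyMeasurable
  simp only [Real.fourier_eq, translationAverage, translationMultiplier, Circle.smul_def,
    smul_eq_mul, Complex.real_smul]
  calc ∫ x, ((Real.fourierChar (-⟪x, ξ⟫) : Circle) : ℂ) * (∫ a, (w a : ℂ) * f (x - θ a) ∂μ)
      = ∫ x, ∫ a, ((Real.fourierChar (-⟪x, ξ⟫) : Circle) : ℂ) * ((w a : ℂ) * f (x - θ a)) ∂μ := by
        simp_rw [integral_const_mul]
    _ = ∫ a, (∫ x, ((Real.fourierChar (-⟪x, ξ⟫) : Circle) : ℂ) * ((w a : ℂ) * f (x - θ a))) ∂μ :=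
        (integral_integral_swap hint2).symm
    _ = ∫ a, (((Real.fourierChar (-⟪θ a, ξ⟫) : Circle) : ℂ) * (w a : ℂ)) *
          (∫ x, ((Real.fourierChar (-⟪x, ξ⟫) : Circle) : ℂ) * f x) ∂μ := by
        refine integral_congr_ae (Filter.Eventually.of_forall fun a => ?_)
        simp only
        rw [← integral_const_mul, ← integral_sub_right_eq_self (fun x =>
          ((Real.fourierChar (-⟪θ a, ξ⟫) : Circle) : ℂ) * (w a : ℂ) *
            (((Real.fourierChar (-⟪x, ξ⟫) : Circle) : ℂ) * f x)) (θ a)]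
        refine integral_congr_ae (Filter.Eventually.of_forall fun x => ?_)
        have : -⟪x, ξ⟫ = -⟪θ a, ξ⟫ + -⟪x - θ a, ξ⟫ := by rw [inner_sub_left]; ring
        simp only [this, AddChar.map_add_eq_mul, Circle.coe_mul]
        ring
    _ = _ := by rw [integral_mul_const]

end TranslationAverage

/-! ### Square-integral bounds through the Fourier transform -/

section Plancherel

open scoped ContDiff Pointwise FourierTransform SchwartzMap

variable {E : Type} [NormedAddCommGroup E] {α : Type*} [MeasurableSpace α] {μ : Measure α}
  {w : α → ℝ} {θ : α → E}

theorem translationAverage_ofReal (ψ : E → ℝ) (x : E) :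
    translationAverage μ w θ (fun x => (ψ x : ℂ)) x =
      ((translationAverage μ w θ ψ x : ℝ) : ℂ) := by
  simp only [translationAverage, smul_eq_mul, Complex.real_smul]
  rw [← integral_complex_ofReal]
  simp

variable [InnerProductSpace ℝ E]

/-- `φ` is a smooth function with compact support contained in `U`. -/
structure IsTestFunction (U : Set E) (φ : E → ℝ) : Prop where
  contDiff : ContDiff ℝ ∞ φ
  hasCompactSupport : HasCompactSupport φ
  tsupport_subset : tsupport φ ⊆ U

theorem coe_toSchwartzMap {f : E → ℂ} (hfc : HasCompactSupport f) (hf : ContDiff ℝ ∞ f) :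
    ⇑(hfc.toSchwartzMap hf) = f := rfl

variable [FiniteDimensional ℝ E] [MeasurableSpace E] [BorelSpace E]

theorem integral_sq_le_of_norm_fourier_le {f g : 𝓢(E, ℂ)} {C : ℝ}
    (h : ∀ ξ, ‖𝓕 g ξ‖ ≤ C * ‖𝓕 f ξ‖) :
    ∫ x, ‖g x‖ ^ 2 ≤ C ^ 2 * ∫ x, ‖f x‖ ^ 2 := by
  have hint : ∀ u : 𝓢(E, ℂ), Integrable fun x => ‖u x‖ ^ 2 := fun u =>
    (memLp_two_iff_integrable_sq_norm u.continuous.aestronglyMeasurable).1 (u.memLp 2)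
  rw [← SchwartzMap.integral_norm_sq_fourier g, ← SchwartzMap.integral_norm_sq_fourier f,
    ← integral_const_mul]
  refine integral_mono (hint _) ((hint _).const_mul _) fun ξ => ?_
  simp only
  rw [← mul_pow]
  exact pow_le_pow_left₀ (norm_nonneg _) (h ξ) 2

variable [SFinite μ]

theorem integral_sq_translationAverage_le (hw : Integrable w μ) (hθ : Measurable θ) {K : Set E}
    (hK : IsCompact K) (hwK : ∀ a, w a ≠ 0 → θ a ∈ K) {C : ℝ}
    (hC : ∀ ξ, ‖translationMultiplier μ w θ ξ‖ ≤ C) {ψ : E → ℝ} (hψ : ContDiff ℝ ∞ ψ)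
    (hψc : HasCompactSupport ψ) :
    ∫ x, translationAverage μ w θ ψ x ^ 2 ≤ C ^ 2 * ∫ x, ψ x ^ 2 := by
  have h1 : HasCompactSupport fun x => (ψ x : ℂ) := hψc.comp_left (g := ((↑) : ℝ → ℂ)) (by simp)
  have h2 : ContDiff ℝ ∞ fun x => (ψ x : ℂ) := Complex.ofRealCLM.contDiff.comp hψ
  have key := integral_sq_le_of_norm_fourier_le (f := h1.toSchwartzMap h2)
    (g := (hasCompactSupport_translationAverage h1 hK hwK).toSchwartzMap
      (contDiff_translationAverage hw hθ h2 h1)) (C := C) fun ξ => by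
    rw [SchwartzMap.fourier_coe, SchwartzMap.fourier_coe]
    simp only [coe_toSchwartzMap]
    rw [fourier_translationAverage hw hθ
      (h2.continuous.integrable_of_hasCompactSupport h1), norm_mul]
    exact mul_le_mul_of_nonneg_right (hC ξ) (norm_nonneg _)
  simpa [translationAverage_ofReal] using key

theorem norm_fourier_fderiv_le {f : E → ℂ} (hf : ContDiff ℝ ∞ f) (hfc : HasCompactSupport f)
    (v ξ : E) :
    ‖𝓕 (fun x => fderiv ℝ f x v) ξ‖ ≤ 2 * Real.pi * ‖v‖ * ‖ξ‖ * ‖𝓕 f ξ‖ := by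
  have h := congrArg (fun u : 𝓢(E, ℂ) => u ξ)
    (SchwartzMap.fourier_lineDerivOp_eq (hfc.toSchwartzMap hf) v)
  rw [SchwartzMap.fourier_coe] at h
  have h3 : ⇑(LineDeriv.lineDerivOp v (hfc.toSchwartzMap hf)) = fun x => fderiv ℝ f x v := rfl
  rw [h3] at h
  rw [h, smul_apply, SchwartzMap.smulLeftCLM_apply_apply (by fun_prop),
    SchwartzMap.fourier_coe]
  simp only [coe_toSchwartzMap]
  rw [norm_smul, norm_smul]
  have h4 : ‖(2 * (Real.pi : ℂ) * Complex.I)‖ = 2 * Real.pi := by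
    simp [abs_of_pos Real.pi_pos]
  rw [h4]
  have h5 : ‖⟪ξ, v⟫‖ ≤ ‖ξ‖ * ‖v‖ := norm_inner_le_norm ξ v
  calc 2 * Real.pi * (‖⟪ξ, v⟫‖ * ‖𝓕 f ξ‖) ≤ 2 * Real.pi * (‖ξ‖ * ‖v‖ * ‖𝓕 f ξ‖) := by
        gcongr
    _ = _ := by ring

/-- If the multiplier decays like `C / ‖ξ‖`, then averaging gains one derivative. -/
theorem integral_sq_fderiv_translationAverage_le (hw : Integrable w μ) (hθ : Measurable θ)
    {K : Set E} (hK : IsCompact K) (hwK : ∀ a, w a ≠ 0 → θ a ∈ K) {C : ℝ}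
    (hC : ∀ ξ, ‖ξ‖ * ‖translationMultiplier μ w θ ξ‖ ≤ C) {ψ : E → ℝ} (hψ : ContDiff ℝ ∞ ψ)
    (hψc : HasCompactSupport ψ) (v : E) :
    ∫ x, (fderiv ℝ (translationAverage μ w θ ψ) x v) ^ 2 ≤
      (2 * Real.pi * ‖v‖ * C) ^ 2 * ∫ x, ψ x ^ 2 := by
  have h1 : HasCompactSupport fun x => (ψ x : ℂ) := hψc.comp_left (g := ((↑) : ℝ → ℂ)) (by simp)
  have h2 : ContDiff ℝ ∞ fun x => (ψ x : ℂ) := Complex.ofRealCLM.contDiff.comp hψ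
  have hdiff : Differentiable ℝ ψ := hψ.differentiable (by simp)
  have hd : ∀ x, fderiv ℝ (fun x => (ψ x : ℂ)) x v = ((fderiv ℝ ψ x v : ℝ) : ℂ) := fun x => by
    have := (Complex.ofRealCLM.hasFDerivAt (x := ψ x)).comp x (hdiff x).hasFDerivAt
    have h' : fderiv ℝ (fun x => (ψ x : ℂ)) x = Complex.ofRealCLM.comp (fderiv ℝ ψ x) :=
      HasFDerivAt.fderiv this
    rw [h']; rfl
  have h3 : HasCompactSupport fun x => ((fderiv ℝ ψ x v : ℝ) : ℂ) :=
    (hψc.fderiv_apply (𝕜 := ℝ) v).comp_left (g := ((↑) : ℝ → ℂ)) (by simp)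
  have h4 : ContDiff ℝ ∞ fun x => ((fderiv ℝ ψ x v : ℝ) : ℂ) :=
    Complex.ofRealCLM.contDiff.comp ((hψ.fderiv_right (by simp)).clm_apply contDiff_const)
  have key := integral_sq_le_of_norm_fourier_le (f := h1.toSchwartzMap h2)
    (g := (hasCompactSupport_translationAverage h3 hK hwK).toSchwartzMap
      (contDiff_translationAverage hw hθ h4 h3)) (C := 2 * Real.pi * ‖v‖ * C) fun ξ => by
    rw [SchwartzMap.fourier_coe, SchwartzMap.fourier_coe]
    simp only [coe_toSchwartzMap]
    rw [fourier_translationAverage hw hθ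
      (h4.continuous.integrable_of_hasCompactSupport h3), norm_mul]
    have h5 := norm_fourier_fderiv_le h2 h1 v ξ
    simp only [hd] at h5
    calc _ ≤ ‖translationMultiplier μ w θ ξ‖ *
          (2 * Real.pi * ‖v‖ * ‖ξ‖ * ‖𝓕 (fun x => (ψ x : ℂ)) ξ‖) := by gcongr
      _ = 2 * Real.pi * ‖v‖ * (‖ξ‖ * ‖translationMultiplier μ w θ ξ‖) *
          ‖𝓕 (fun x => (ψ x : ℂ)) ξ‖ := by ring
      _ ≤ _ := by gcongr; exact hC ξ
  simp only [coe_toSchwartzMap] at key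
  have h6 := fderiv_translationAverage_apply (F := ℝ) hw hθ (hψ.of_le (by simp)) hψc
  simp only [h6]
  simpa [translationAverage_ofReal] using key

end Plancherel

/-! ### The homotopy operator -/

section Radial

open scoped ContDiff Pointwise FourierTransform SchwartzMap unitInterval

variable {E : Type} [NormedAddCommGroup E] [InnerProductSpace ℝ E]

variable {κ : E → ℝ}

/-- The union of the segments joining the origin to the points of the support of `κ`. -/
def radialHull (κ : E → ℝ) : Set E :=
  (fun p : ℝ × E => p.1 • p.2) '' (Set.Icc 0 1 ×ˢ tsupport κ)

theorem isCompact_radialHull (hκc : HasCompactSupport κ) : IsCompact (radialHull κ) :=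
  (isCompact_Icc.prod hκc).image (by fun_prop)

theorem mem_radialHull (p : I × E) (hp : κ p.2 ≠ 0) : (p.1 : ℝ) • p.2 ∈ radialHull κ :=
  ⟨(p.1, p.2), ⟨p.1.2, subset_tsupport _ hp⟩, rfl⟩

/-- The fundamental theorem of calculus along the segment from `x` to `x - z`. -/
theorem integral_fderiv_ray {ψ : E → ℝ} (hψ : ContDiff ℝ ∞ ψ) (x z : E) :
    ∫ s in (0 : ℝ)..1, fderiv ℝ ψ (x - s • z) z = ψ x - ψ (x - z) := by
  have h : ∀ s ∈ Set.uIcc (0 : ℝ) 1,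
      HasDerivAt (fun s : ℝ => - ψ (x - s • z)) (fderiv ℝ ψ (x - s • z) z) s := fun s _ => by
    have h1 : HasDerivAt (fun s : ℝ => x - s • z) (-z) s := by
      simpa using ((hasDerivAt_id s).smul_const z).const_sub x
    have h2 : HasDerivAt (fun s : ℝ => ψ (x - s • z)) (fderiv ℝ ψ (x - s • z) (-z)) s :=
      (hψ.differentiable (by simp) _).hasFDerivAt.comp_hasDerivAt s h1
    simpa using h2.fun_neg
  rw [intervalIntegral.integral_eq_sub_of_hasDerivAt h]
  · simp; ring
  · refine Continuous.intervalIntegrable ?_ _ _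
    exact ((hψ.continuous_fderiv (by simp)).comp (by fun_prop)).clm_apply continuous_const

variable [FiniteDimensional ℝ E] [MeasurableSpace E] [BorelSpace E]

/-- The operator `ψ ↦ (x ↦ ∫₀¹ ∫ κ(z) ψ(x - s z) dz ds)`. -/
def radialAverage (κ ψ : E → ℝ) : E → ℝ :=
  translationAverage ((volume : Measure I).prod (volume : Measure E)) (fun p => κ p.2)
    (fun p => (p.1 : ℝ) • p.2) ψ

theorem integrable_radial (hκ : Integrable κ) :
    Integrable (fun p : I × E => κ p.2) ((volume : Measure I).prod (volume : Measure E)) :=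
  hκ.comp_snd _

theorem measurable_radial : Measurable fun p : I × E => (p.1 : ℝ) • p.2 := by
  fun_prop

theorem exists_norm_fourier_le (f : 𝓢(E, ℂ)) :
    ∃ C, 0 ≤ C ∧ ∀ ξ, ‖𝓕 f ξ‖ ≤ C / (1 + ‖ξ‖ ^ 2) := by
  obtain ⟨C₀, h₀, hC₀⟩ := (𝓕 f).decay 0 0
  obtain ⟨C₂, h₂, hC₂⟩ := (𝓕 f).decay 2 0
  refine ⟨C₀ + C₂, by positivity, fun ξ => ?_⟩
  rw [le_div_iff₀ (by positivity)]
  have a := hC₀ ξ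
  have b := hC₂ ξ
  simp only [norm_iteratedFDeriv_zero, pow_zero, one_mul] at a b
  linarith

theorem integral_unitInterval (f : ℝ → ℝ) : ∫ s : I, f s = ∫ s in (0 : ℝ)..1, f s := by
  rw [intervalIntegral.integral_of_le zero_le_one, ← integral_Icc_eq_integral_Ioc]
  exact integral_subtype measurableSet_Icc f

/-- The integrand is the derivative of `s ↦ arctan (s a)`; the bound is uniform in `a`. -/
theorem integral_div_one_add_sq_le (a : ℝ) :
    ∫ s in (0 : ℝ)..1, a / (1 + (s * a) ^ 2) ≤ Real.pi / 2 := by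
  have h : ∀ s ∈ Set.uIcc (0 : ℝ) 1,
      HasDerivAt (fun s => Real.arctan (s * a)) (a / (1 + (s * a) ^ 2)) s := fun s _ => by
    have := ((hasDerivAt_id s).mul_const a).arctan
    simpa [div_eq_inv_mul] using this
  rw [intervalIntegral.integral_eq_sub_of_hasDerivAt h]
  · simpa using (Real.arctan_lt_pi_div_two a).le
  · refine Continuous.intervalIntegrable ?_ _ _
    exact continuous_const.div (by fun_prop) fun s => by positivity

/-- The multiplier of the radial average is `∫₀¹ κ̂(s ξ) ds`. Since `κ̂` decays like
`1 / (1 + ‖ξ‖²)`, the substitution `t = s ‖ξ‖` bounds `‖ξ‖` times this integral. -/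
theorem exists_radial_multiplier_le (hκ : ContDiff ℝ ∞ κ) (hκc : HasCompactSupport κ) :
    ∃ C, ∀ ξ, ‖ξ‖ * ‖translationMultiplier ((volume : Measure I).prod (volume : Measure E))
      (fun p => κ p.2) (fun p => (p.1 : ℝ) • p.2) ξ‖ ≤ C := by
  have h1 : HasCompactSupport fun x => (κ x : ℂ) := hκc.comp_left (g := ((↑) : ℝ → ℂ)) (by simp)
  have h2 : ContDiff ℝ ∞ fun x => (κ x : ℂ) := Complex.ofRealCLM.contDiff.comp hκ
  obtain ⟨C, hC0, hC⟩ := exists_norm_fourier_le (h1.toSchwartzMap h2)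
  refine ⟨C * (Real.pi / 2), fun ξ => ?_⟩
  have hint : Integrable (fun p : I × E => ((Real.fourierChar (-⟪(p.1 : ℝ) • p.2, ξ⟫) : Circle) : ℂ)
      * (κ p.2 : ℂ)) ((volume : Measure I).prod (volume : Measure E)) := by
    refine (integrable_radial (hκ.continuous.integrable_of_hasCompactSupport hκc)).ofReal.bdd_mul
      (c := 1) ?_ (Filter.Eventually.of_forall fun p => (Circle.norm_coe _).le)
    have hc : Continuous fun x : E => ((Real.fourierChar (-⟪x, ξ⟫) : Circle) : ℂ) :=
      continuous_subtype_val.comp (Real.continuous_fourierChar.comp (by fun_prop))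
    exact (hc.measurable.comp measurable_radial).aestronglyMeasurable
  have hM : translationMultiplier ((volume : Measure I).prod (volume : Measure E))
      (fun p => κ p.2) (fun p => (p.1 : ℝ) • p.2) ξ =
      ∫ s : I, 𝓕 (h1.toSchwartzMap h2) ((s : ℝ) • ξ) := by
    rw [translationMultiplier, integral_prod _ hint]
    refine integral_congr_ae (Filter.Eventually.of_forall fun s => ?_)
    rw [SchwartzMap.fourier_coe, coe_toSchwartzMap]
    simp only [Real.fourier_eq, Circle.smul_def, smul_eq_mul, real_inner_smul_left,
      real_inner_smul_right]
  rw [hM]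
  have hbd : ‖∫ s : I, 𝓕 (h1.toSchwartzMap h2) ((s : ℝ) • ξ)‖ ≤
      ∫ s : I, C / (1 + ((s : ℝ) * ‖ξ‖) ^ 2) := by
    refine norm_integral_le_of_norm_le ?_ (Filter.Eventually.of_forall fun s => ?_)
    · refine Continuous.integrable_of_hasCompactSupport ?_ (HasCompactSupport.of_compactSpace _)
      exact continuous_const.div (by fun_prop) fun s => by positivity
    · have := hC ((s : ℝ) • ξ)
      rwa [norm_smul, Real.norm_of_nonneg s.2.1] at this
  rw [integral_unitInterval fun s => C / (1 + (s * ‖ξ‖) ^ 2)] at hbd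
  calc _ ≤ ‖ξ‖ * ∫ s in (0 : ℝ)..1, C / (1 + (s * ‖ξ‖) ^ 2) := by gcongr
    _ = C * ∫ s in (0 : ℝ)..1, ‖ξ‖ / (1 + (s * ‖ξ‖) ^ 2) := by
      rw [← intervalIntegral.integral_const_mul, ← intervalIntegral.integral_const_mul]
      congr 1
      ext s
      ring
    _ ≤ _ := by gcongr; exact integral_div_one_add_sq_le _

theorem contDiff_radialAverage (hκ : ContDiff ℝ ∞ κ) (hκc : HasCompactSupport κ) {ψ : E → ℝ}
    (hψ : ContDiff ℝ ∞ ψ) (hψc : HasCompactSupport ψ) : ContDiff ℝ ∞ (radialAverage κ ψ) :=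
  contDiff_translationAverage
    (integrable_radial (hκ.continuous.integrable_of_hasCompactSupport hκc)) measurable_radial hψ hψc

theorem hasCompactSupport_radialAverage (hκc : HasCompactSupport κ) {ψ : E → ℝ}
    (hψc : HasCompactSupport ψ) : HasCompactSupport (radialAverage κ ψ) :=
  hasCompactSupport_translationAverage hψc (isCompact_radialHull hκc) mem_radialHull

theorem tsupport_radialAverage_subset (hκc : HasCompactSupport κ) {ψ : E → ℝ}
    (hψc : HasCompactSupport ψ) :
    tsupport (radialAverage κ ψ) ⊆ tsupport ψ + radialHull κ :=
  tsupport_translationAverage_subset hψc (isCompact_radialHull hκc) mem_radialHull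

theorem exists_integral_sq_radialAverage_le (hκ : ContDiff ℝ ∞ κ) (hκc : HasCompactSupport κ) :
    ∃ C, ∀ ψ : E → ℝ, ContDiff ℝ ∞ ψ → HasCompactSupport ψ →
      ∫ x, radialAverage κ ψ x ^ 2 ≤ C ^ 2 * ∫ x, ψ x ^ 2 :=
  ⟨_, fun _ hψ hψc => integral_sq_translationAverage_le
    (integrable_radial (hκ.continuous.integrable_of_hasCompactSupport hκc)) measurable_radial
    (isCompact_radialHull hκc) mem_radialHull norm_translationMultiplier_le hψ hψc⟩

/-- The operator `radialAverage κ` gains one derivative in `L²`: its Fourier multiplier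
`∫₀¹ κ̂(s ξ) ds` decays like `1 / ‖ξ‖`. -/
theorem exists_integral_sq_fderiv_radialAverage_le (hκ : ContDiff ℝ ∞ κ)
    (hκc : HasCompactSupport κ) (v : E) :
    ∃ C, ∀ ψ : E → ℝ, ContDiff ℝ ∞ ψ → HasCompactSupport ψ →
      ∫ x, (fderiv ℝ (radialAverage κ ψ) x v) ^ 2 ≤ C ^ 2 * ∫ x, ψ x ^ 2 := by
  obtain ⟨C, hC⟩ := exists_radial_multiplier_le hκ hκc
  exact ⟨_, fun _ hψ hψc => integral_sq_fderiv_translationAverage_le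
    (integrable_radial (hκ.continuous.integrable_of_hasCompactSupport hκc)) measurable_radial
    (isCompact_radialHull hκc) mem_radialHull hC hψ hψc v⟩

theorem fderiv_radialAverage_apply (hκ : ContDiff ℝ ∞ κ) (hκc : HasCompactSupport κ) {ψ : E → ℝ}
    (hψ : ContDiff ℝ ∞ ψ) (hψc : HasCompactSupport ψ) (x v : E) :
    fderiv ℝ (radialAverage κ ψ) x v = radialAverage κ (fun y => fderiv ℝ ψ y v) x :=
  fderiv_translationAverage_apply (F := ℝ)
    (integrable_radial (hκ.continuous.integrable_of_hasCompactSupport hκc)) measurable_radial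
    (hψ.of_le (by simp)) hψc x v

end Radial

section Homotopy

open scoped ContDiff Pointwise unitInterval

variable {d : ℕ}

/-- The Euclidean space `ℝ^d`. -/
abbrev Space (d : ℕ) : Type := EuclideanSpace ℝ (Fin d)

/-- The `i`-th partial derivative of a function on `ℝ^d`. -/
def pderiv (i : Fin d) (f : Space d → ℝ) (x : Space d) : ℝ :=
  fderiv ℝ f x (EuclideanSpace.single i 1)

theorem fderiv_eq_sum_pderiv (f : Space d → ℝ) (x z : Space d) :
    fderiv ℝ f x z = ∑ i, z i * pderiv i f x := by
  have hz : z = ∑ i, z i • EuclideanSpace.single i (1 : ℝ) := by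
    ext j
    simp [Finset.sum_apply, Pi.single_apply]
  conv_lhs => rw [hz]
  simp [pderiv]

/-- The components `R_m` of the homotopy operator with kernel `φ`:
`R_m ψ (x) = ∫₀¹ ∫ z_m φ(z) ψ(x - s z) dz ds`. -/
def homotopyOp (φ : Space d → ℝ) (m : Fin d) (ψ : Space d → ℝ) : Space d → ℝ :=
  radialAverage (fun z => z m * φ z) ψ

variable {φ : Space d → ℝ}

theorem contDiff_coord_mul (hφ : ContDiff ℝ ∞ φ) (m : Fin d) :
    ContDiff ℝ ∞ fun z => z m * φ z :=
  ContDiff.mul (EuclideanSpace.proj (𝕜 := ℝ) m).contDiff hφ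

theorem hasCompactSupport_coord_mul (hφc : HasCompactSupport φ) (m : Fin d) :
    HasCompactSupport fun z => z m * φ z := hφc.mul_left

/-- The homotopy formula: `∑ₘ ∂ₘ Rₘ ψ = ψ - φ * ψ` if `∫ φ = 1`. -/
theorem sum_pderiv_homotopyOp (hφ : ContDiff ℝ ∞ φ) (hφc : HasCompactSupport φ)
    (hφ1 : ∫ z, φ z = 1) {ψ : Space d → ℝ} (hψ : ContDiff ℝ ∞ ψ)
    (hψc : HasCompactSupport ψ) (x : Space d) :
    ∑ m, pderiv m (homotopyOp φ m ψ) x = ψ x - ∫ z, φ z * ψ (x - z) := by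
  have hd : ∀ m, ContDiff ℝ ∞ fun y => fderiv ℝ ψ y (EuclideanSpace.single m 1) := fun m =>
    (hψ.fderiv_right (by simp)).clm_apply contDiff_const
  have hint : ∀ m, Integrable (fun p : I × Space d => (p.2 m * φ p.2) •
      fderiv ℝ ψ (x - (p.1 : ℝ) • p.2) (EuclideanSpace.single m 1))
      ((volume : Measure I).prod volume) := fun m =>
    integrable_translate (integrable_radial ((contDiff_coord_mul hφ m).continuous
      |>.integrable_of_hasCompactSupport (hasCompactSupport_coord_mul hφc m)))
      measurable_radial (hd m).continuous (hψc.fderiv_apply (𝕜 := ℝ) _) x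
  have hsum : ∀ p : I × Space d, ∑ m, (p.2 m * φ p.2) •
      fderiv ℝ ψ (x - (p.1 : ℝ) • p.2) (EuclideanSpace.single m 1) =
      φ p.2 * fderiv ℝ ψ (x - (p.1 : ℝ) • p.2) p.2 := fun p => by
    rw [fderiv_eq_sum_pderiv, Finset.mul_sum]
    refine Finset.sum_congr rfl fun m _ => ?_
    simp only [pderiv, smul_eq_mul]
    ring
  calc ∑ m, pderiv m (homotopyOp φ m ψ) x
      = ∑ m, ∫ p : I × Space d, (p.2 m * φ p.2) •
          fderiv ℝ ψ (x - (p.1 : ℝ) • p.2) (EuclideanSpace.single m 1)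
          ∂((volume : Measure I).prod volume) := by
        refine Finset.sum_congr rfl fun m _ => ?_
        exact fderiv_radialAverage_apply (contDiff_coord_mul hφ m)
          (hasCompactSupport_coord_mul hφc m) hψ hψc x _
    _ = ∫ p : I × Space d, φ p.2 * fderiv ℝ ψ (x - (p.1 : ℝ) • p.2) p.2
          ∂((volume : Measure I).prod volume) := by
        rw [← integral_finsetSum _ fun m _ => hint m]
        simp_rw [hsum]
    _ = ∫ z, ∫ s : I, φ z * fderiv ℝ ψ (x - (s : ℝ) • z) z := by
        rw [integral_prod_symm]
        simp_rw [← hsum]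
        exact integrable_finsetSum _ fun m _ => hint m
    _ = ∫ z, (φ z * ψ x - φ z * ψ (x - z)) := by
        congr 1
        ext z
        rw [integral_const_mul, integral_unitInterval fun s => fderiv ℝ ψ (x - s • z) z,
          integral_fderiv_ray hψ, mul_sub]
    _ = ψ x - ∫ z, φ z * ψ (x - z) := by
        have hφi := hφ.continuous.integrable_of_hasCompactSupport (μ := volume) hφc
        have : Integrable fun z => φ z * ψ (x - z) :=
          integrable_translate hφi measurable_id hψ.continuous hψc x
        rw [integral_sub (hφi.mul_const _) this, integral_mul_const, hφ1, one_mul]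

end Homotopy

/-! ### Representation of bounded functionals -/

section Riesz

open scoped ContDiff

/-- A functional that is bounded by the seminorm `v ↦ ‖i v‖` factors through the range of `i`, so
it is represented by a vector of `H`, by the theorems of Hahn–Banach and Riesz. -/
theorem exists_forall_eq_inner {V H : Type*} [AddCommGroup V] [Module ℝ V] [NormedAddCommGroup H]
    [InnerProductSpace ℝ H] [CompleteSpace H] (i : V →ₗ[ℝ] H) (L : V →ₗ[ℝ] ℝ) (C : ℝ)
    (h : ∀ v, |L v| ≤ C * ‖i v‖) : ∃ q : H, ∀ v, L v = ⟪q, i v⟫ := by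
  have hker : LinearMap.ker i ≤ LinearMap.ker L := fun v hv => by
    have := h v
    rw [LinearMap.mem_ker.1 hv, norm_zero, mul_zero] at this
    exact abs_nonpos_iff.1 this
  let f : LinearMap.range i →ₗ[ℝ] ℝ :=
    (LinearMap.ker i).liftQ L hker ∘ₗ i.quotKerEquivRange.symm.toLinearMap
  have hf : ∀ v, f ⟨i v, LinearMap.mem_range_self i v⟩ = L v := fun v => by
    have : i.quotKerEquivRange.symm ⟨i v, LinearMap.mem_range_self i v⟩ =
        (LinearMap.ker i).mkQ v := by
      rw [LinearEquiv.symm_apply_eq]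
      rfl
    simp [f, this]
  have hbound : ∀ y, ‖f y‖ ≤ C * ‖y‖ := by
    rintro ⟨_, v, rfl⟩
    rw [hf]
    exact h v
  obtain ⟨g, hg⟩ := StrongDual.exists_extension _ (f.mkContinuous C hbound)
  refine ⟨(InnerProductSpace.toDual ℝ H).symm g, fun v => ?_⟩
  rw [InnerProductSpace.toDual_symm_apply, ← hf v]
  exact (hg ⟨i v, LinearMap.mem_range_self i v⟩).symm

variable {E : Type} [NormedAddCommGroup E] [InnerProductSpace ℝ E] [FiniteDimensional ℝ E]
  [MeasurableSpace E] [BorelSpace E]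

/-- The vector space of smooth functions with compact support. -/
def testSpace (E : Type) [NormedAddCommGroup E] [InnerProductSpace ℝ E] : Submodule ℝ (E → ℝ) where
  carrier := {ψ | ContDiff ℝ ∞ ψ ∧ HasCompactSupport ψ}
  add_mem' h h' := ⟨h.1.add h'.1, h.2.add h'.2⟩
  zero_mem' := ⟨contDiff_const, HasCompactSupport.zero⟩
  smul_mem' _ _ h := ⟨contDiff_const.smul h.1, h.2.smul_left⟩

theorem memLp_of_mem_testSpace {ψ : E → ℝ} (h : ψ ∈ testSpace E) (p : ENNReal) :
    MemLp ψ p (volume : Measure E) :=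
  h.1.continuous.memLp_of_hasCompactSupport h.2

/-- A functional on test functions that is bounded in the `L²` norm is given by a square integrable
function. -/
theorem exists_memLp_forall_eq_integral (L : testSpace E →ₗ[ℝ] ℝ) (C : ℝ)
    (h : ∀ ψ : testSpace E, |L ψ| ≤ C * √(∫ x, (ψ : E → ℝ) x ^ 2)) :
    ∃ q : E → ℝ, MemLp q 2 ∧ ∀ ψ : testSpace E, L ψ = ∫ x, q x * (ψ : E → ℝ) x := by
  let i : testSpace E →ₗ[ℝ] Lp ℝ 2 (volume : Measure E) :=
    { toFun ψ := (memLp_of_mem_testSpace ψ.2 2).toLp _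
      map_add' _ _ := rfl
      map_smul' _ _ := rfl }
  have hi : ∀ ψ : testSpace E, (i ψ : E → ℝ) =ᵐ[volume] ψ := fun ψ =>
    (memLp_of_mem_testSpace ψ.2 2).coeFn_toLp
  have hnorm : ∀ ψ : testSpace E, ‖i ψ‖ = √(∫ x, (ψ : E → ℝ) x ^ 2) := fun ψ => by
    rw [norm_eq_sqrt_real_inner, L2.inner_def]
    congr 1
    refine integral_congr_ae ?_
    filter_upwards [hi ψ] with x hx
    rw [hx]
    simp [sq]
  obtain ⟨q, hq⟩ := exists_forall_eq_inner i L C fun ψ => by rw [hnorm]; exact h ψ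
  refine ⟨q, Lp.memLp q, fun ψ => ?_⟩
  rw [hq, L2.inner_def]
  refine integral_congr_ae ?_
  filter_upwards [hi ψ] with x hx
  rw [hx]
  simp [mul_comm]

/-- The Cauchy–Schwarz inequality. -/
theorem abs_integral_mul_le {f g : E → ℝ} (hf : MemLp f 2) (hg : MemLp g 2) :
    |∫ x, f x * g x| ≤ √(∫ x, f x ^ 2) * √(∫ x, g x ^ 2) := by
  have key := abs_real_inner_le_norm (hf.toLp f) (hg.toLp g)
  have h1 : ∀ {u v : E → ℝ} (hu : MemLp u 2) (hv : MemLp v 2),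
      ⟪hu.toLp u, hv.toLp v⟫ = ∫ x, u x * v x := fun {u v} hu hv => by
    rw [L2.inner_def]
    refine integral_congr_ae ?_
    filter_upwards [hu.coeFn_toLp, hv.coeFn_toLp] with x hx hy
    rw [hx, hy]
    simp [mul_comm]
  rw [norm_eq_sqrt_real_inner, norm_eq_sqrt_real_inner, h1, h1, h1] at key
  simpa [sq] using key

end Riesz

/-! ### Distributions of the form `g + div F` -/

section DivFunctional

open scoped ContDiff Pointwise

variable {d : ℕ}

theorem contDiff_pderiv {f : Space d → ℝ} (hf : ContDiff ℝ ∞ f) (i : Fin d) :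
    ContDiff ℝ ∞ (pderiv i f) :=
  (hf.fderiv_right (by simp)).clm_apply contDiff_const

theorem hasCompactSupport_pderiv {f : Space d → ℝ} (hf : HasCompactSupport f) (i : Fin d) :
    HasCompactSupport (pderiv i f) :=
  hf.fderiv_apply (𝕜 := ℝ) _

theorem tsupport_pderiv_subset (f : Space d → ℝ) (i : Fin d) : tsupport (pderiv i f) ⊆ tsupport f :=
  tsupport_fderiv_apply_subset ℝ _

theorem IsTestFunction.pderiv {U : Set (Space d)} {f : Space d → ℝ} (hf : IsTestFunction U f)
    (i : Fin d) :
    IsTestFunction U (pderiv i f) :=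
  ⟨contDiff_pderiv hf.1 i, hasCompactSupport_pderiv hf.2 i,
    (tsupport_pderiv_subset f i).trans hf.3⟩

theorem pderiv_add {f f' : Space d → ℝ} (hf : ContDiff ℝ ∞ f) (hf' : ContDiff ℝ ∞ f') (i : Fin d) :
    pderiv i (fun x => f x + f' x) = fun x => pderiv i f x + pderiv i f' x := by
  ext x
  simp only [pderiv]
  rw [fderiv_fun_add (hf.differentiable (by simp) x) (hf'.differentiable (by simp) x)]
  rfl

theorem pderiv_const_mul {f : Space d → ℝ} (hf : ContDiff ℝ ∞ f) (c : ℝ) (i : Fin d) :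
    pderiv i (fun x => c * f x) = fun x => c * pderiv i f x := by
  ext x
  simp only [pderiv]
  rw [fderiv_const_mul (hf.differentiable (by simp) x)]
  rfl

theorem pderiv_comm {f : Space d → ℝ} (hf : ContDiff ℝ ∞ f) (i j : Fin d) :
    pderiv i (pderiv j f) = pderiv j (pderiv i f) := by
  have hd : Differentiable ℝ (fderiv ℝ f) :=
    (hf.fderiv_right (m := ∞) (by simp)).differentiable (by simp)
  have h : ∀ (i j : Fin d) (x : Space d), pderiv i (pderiv j f) x =
      fderiv ℝ (fderiv ℝ f) x (EuclideanSpace.single i 1) (EuclideanSpace.single j 1) :=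
    fun i j x => by
      unfold pderiv
      rw [fderiv_clm_apply (hd x) (differentiableAt_const _)]
      simp
  ext x
  rw [h, h]
  exact (hf.contDiffAt.isSymmSndFDerivAt (by simpa using ENat.LEInfty.out)).eq _ _

theorem integrable_mul_of_memLp {f g : Space d → ℝ} (hf : MemLp f 2) (hg : ContDiff ℝ ∞ g)
    (hgc : HasCompactSupport g) : Integrable fun x => f x * g x :=
  MemLp.integrable_mul (p := 2) (q := 2) hf (hg.continuous.memLp_of_hasCompactSupport hgc)

/-- The distribution `g + ∑ₗ ∂ₗ Fₗ`, evaluated at `ψ`. -/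
def divFunctional (g : Space d → ℝ) (F : Fin d → Space d → ℝ) (ψ : Space d → ℝ) : ℝ :=
  (∫ x, g x * ψ x) - ∑ l, ∫ x, F l x * pderiv l ψ x

variable {g : Space d → ℝ} {F : Fin d → Space d → ℝ}

theorem divFunctional_add (hg : MemLp g 2) (hF : ∀ l, MemLp (F l) 2) {ψ χ : Space d → ℝ}
    (hψ : ContDiff ℝ ∞ ψ) (hψc : HasCompactSupport ψ) (hχ : ContDiff ℝ ∞ χ)
    (hχc : HasCompactSupport χ) :
    divFunctional g F (fun x => ψ x + χ x) = divFunctional g F ψ + divFunctional g F χ := by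
  simp only [divFunctional, pderiv_add hψ hχ, mul_add]
  rw [integral_add (integrable_mul_of_memLp hg hψ hψc) (integrable_mul_of_memLp hg hχ hχc)]
  have : ∀ l, ∫ x, (F l x * pderiv l ψ x + F l x * pderiv l χ x) =
      (∫ x, F l x * pderiv l ψ x) + ∫ x, F l x * pderiv l χ x := fun l =>
    integral_add
      (integrable_mul_of_memLp (hF l) (contDiff_pderiv hψ l) (hasCompactSupport_pderiv hψc l))
      (integrable_mul_of_memLp (hF l) (contDiff_pderiv hχ l) (hasCompactSupport_pderiv hχc l))
  simp only [this, Finset.sum_add_distrib]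
  ring

theorem divFunctional_const_mul {ψ : Space d → ℝ} (hψ : ContDiff ℝ ∞ ψ) (c : ℝ) :
    divFunctional g F (fun x => c * ψ x) = c * divFunctional g F ψ := by
  simp only [divFunctional, pderiv_const_mul hψ, mul_left_comm _ c, integral_const_mul,
    ← Finset.mul_sum]
  ring

theorem divFunctional_zero : divFunctional g F (fun _ => 0) = 0 := by
  have : ∀ l, pderiv l (fun _ : Space d => (0 : ℝ)) = fun _ => 0 := fun l => by
    ext x; simp [pderiv]
  simp [divFunctional, this]

theorem divFunctional_sum (hg : MemLp g 2) (hF : ∀ l, MemLp (F l) 2) {ι : Type*} (s : Finset ι)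
    {ψ : ι → Space d → ℝ} (hψ : ∀ i, ContDiff ℝ ∞ (ψ i)) (hψc : ∀ i, HasCompactSupport (ψ i)) :
    divFunctional g F (fun x => ∑ i ∈ s, ψ i x) = ∑ i ∈ s, divFunctional g F (ψ i) := by
  classical
  induction s using Finset.induction_on with
  | empty => simp [divFunctional_zero]
  | insert a s ha ih =>
    have h1 : HasCompactSupport fun x => ∑ i ∈ s, ψ i x := by
      have := Submodule.sum_mem (testSpace (Space d)) (t := s) (f := ψ) fun i _ => ⟨hψ i, hψc i⟩
      rw [show ∑ i ∈ s, ψ i = fun x => ∑ i ∈ s, ψ i x from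
        funext fun x => Finset.sum_apply x s ψ] at this
      exact this.2
    simp only [Finset.sum_insert ha]
    rw [divFunctional_add hg hF (hψ a) (hψc a) (ContDiff.sum fun i _ => hψ i) h1, ih]

/-- The distribution `g + ∑ₗ ∂ₗ Fₗ` with square integrable data is bounded on `H¹`. -/
theorem abs_divFunctional_le (hg : MemLp g 2) (hF : ∀ l, MemLp (F l) 2) {ψ : Space d → ℝ}
    (hψ : ContDiff ℝ ∞ ψ) (hψc : HasCompactSupport ψ) :
    |divFunctional g F ψ| ≤ √(∫ x, g x ^ 2) * √(∫ x, ψ x ^ 2) +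
      ∑ l, √(∫ x, F l x ^ 2) * √(∫ x, pderiv l ψ x ^ 2) := by
  refine (abs_sub _ _).trans (add_le_add ?_ ?_)
  · exact abs_integral_mul_le hg (hψ.continuous.memLp_of_hasCompactSupport hψc)
  · refine (Finset.abs_sum_le_sum_abs _ _).trans (Finset.sum_le_sum fun l _ => ?_)
    exact abs_integral_mul_le (hF l) ((contDiff_pderiv hψ l).continuous.memLp_of_hasCompactSupport
      (hasCompactSupport_pderiv hψc l))

/-- The distributions `Tₖ = gₖ + ∑ₗ ∂ₗ Fₖₗ` satisfy `∂ₖ Tₘ = ∂ₘ Tₖ` on `U`. -/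
def IsClosedOn (U : Set (Space d)) (g : Fin d → Space d → ℝ)
    (F : Fin d → Fin d → Space d → ℝ) : Prop :=
  ∀ k m χ, IsTestFunction U χ →
    divFunctional (g m) (F m) (pderiv k χ) = divFunctional (g k) (F k) (pderiv m χ)

/-- The function `q` satisfies `∂ₖ q = gₖ + ∑ₗ ∂ₗ Fₖₗ` on `U`, in the sense of distributions. -/
def IsPrimitiveOn (U : Set (Space d)) (q : Space d → ℝ) (g : Fin d → Space d → ℝ)
    (F : Fin d → Fin d → Space d → ℝ) : Prop :=
  ∀ k ψ, IsTestFunction U ψ → ∫ x, q x * pderiv k ψ x = - divFunctional (g k) (F k) ψ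

end DivFunctional

section HomotopyFunctional

open scoped ContDiff Pointwise

variable {d : ℕ}

variable {g : Fin d → Space d → ℝ} {F : Fin d → Fin d → Space d → ℝ} {φ : Space d → ℝ}

theorem contDiff_homotopyOp (hφ : ContDiff ℝ ∞ φ) (hφc : HasCompactSupport φ) (m : Fin d)
    {ψ : Space d → ℝ} (hψ : ContDiff ℝ ∞ ψ) (hψc : HasCompactSupport ψ) :
    ContDiff ℝ ∞ (homotopyOp φ m ψ) :=
  contDiff_radialAverage (contDiff_coord_mul hφ m) (hasCompactSupport_coord_mul hφc m) hψ hψc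

theorem hasCompactSupport_homotopyOp (hφc : HasCompactSupport φ) (m : Fin d)
    {ψ : Space d → ℝ} (hψc : HasCompactSupport ψ) : HasCompactSupport (homotopyOp φ m ψ) :=
  hasCompactSupport_radialAverage (hasCompactSupport_coord_mul hφc m) hψc

theorem tsupport_homotopyOp_subset (hφc : HasCompactSupport φ) (m : Fin d)
    {ψ : Space d → ℝ} (hψc : HasCompactSupport ψ) :
    tsupport (homotopyOp φ m ψ) ⊆ tsupport ψ + radialHull φ := by
  refine (tsupport_radialAverage_subset (hasCompactSupport_coord_mul hφc m) hψc).trans ?_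
  refine Set.add_subset_add_left (Set.image_mono (Set.prod_mono_right ?_))
  exact tsupport_mul_subset_right

theorem pderiv_homotopyOp (hφ : ContDiff ℝ ∞ φ) (hφc : HasCompactSupport φ) (m k : Fin d)
    {ψ : Space d → ℝ} (hψ : ContDiff ℝ ∞ ψ) (hψc : HasCompactSupport ψ) :
    pderiv k (homotopyOp φ m ψ) = homotopyOp φ m (pderiv k ψ) :=
  funext fun x => fderiv_radialAverage_apply (contDiff_coord_mul hφ m)
    (hasCompactSupport_coord_mul hφc m) hψ hψc x _

theorem homotopyOp_add (hφ : ContDiff ℝ ∞ φ) (hφc : HasCompactSupport φ) (m : Fin d)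
    {ψ χ : Space d → ℝ} (hψ : ContDiff ℝ ∞ ψ) (hψc : HasCompactSupport ψ) (hχ : ContDiff ℝ ∞ χ)
    (hχc : HasCompactSupport χ) :
    homotopyOp φ m (fun x => ψ x + χ x) = fun x => homotopyOp φ m ψ x + homotopyOp φ m χ x := by
  have hint := integrable_radial ((contDiff_coord_mul hφ m).continuous
    |>.integrable_of_hasCompactSupport (μ := volume) (hasCompactSupport_coord_mul hφc m))
  ext x
  simp only [homotopyOp, radialAverage, translationAverage, smul_add]
  exact integral_add (integrable_translate hint measurable_radial hψ.continuous hψc x)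
    (integrable_translate hint measurable_radial hχ.continuous hχc x)

theorem homotopyOp_const_mul (m : Fin d) (ψ : Space d → ℝ) (c : ℝ) :
    homotopyOp φ m (fun x => c * ψ x) = fun x => c * homotopyOp φ m ψ x := by
  ext x
  simp only [homotopyOp, radialAverage, translationAverage, smul_eq_mul, mul_left_comm _ c]
  exact integral_const_mul _ _

/-- The functional `ψ ↦ -∑ₘ Tₘ(Rₘ ψ)` is bounded in `L²`, hence is given by a square integrable
function. This is where the gain of one derivative by the homotopy operator is used. -/
theorem exists_memLp_homotopy (hg : ∀ k, MemLp (g k) 2) (hF : ∀ k l, MemLp (F k l) 2)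
    (hφ : ContDiff ℝ ∞ φ) (hφc : HasCompactSupport φ) :
    ∃ q : Space d → ℝ, MemLp q 2 ∧ ∀ ψ : Space d → ℝ, ContDiff ℝ ∞ ψ → HasCompactSupport ψ →
      ∫ x, q x * ψ x = - ∑ m, divFunctional (g m) (F m) (homotopyOp φ m ψ) := by
  let L : testSpace (Space d) →ₗ[ℝ] ℝ :=
    { toFun ψ := - ∑ m, divFunctional (g m) (F m) (homotopyOp φ m ψ)
      map_add' ψ χ := by
        have : ∀ m, divFunctional (g m) (F m)
            (homotopyOp φ m ((ψ + χ : testSpace (Space d)) : Space d → ℝ)) =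
            divFunctional (g m) (F m) (homotopyOp φ m ψ) +
              divFunctional (g m) (F m) (homotopyOp φ m χ) := fun m => by
          rw [← divFunctional_add (hg m) (hF m) (contDiff_homotopyOp hφ hφc m ψ.2.1 ψ.2.2)
            (hasCompactSupport_homotopyOp hφc m ψ.2.2) (contDiff_homotopyOp hφ hφc m χ.2.1 χ.2.2)
            (hasCompactSupport_homotopyOp hφc m χ.2.2),
            ← homotopyOp_add hφ hφc m ψ.2.1 ψ.2.2 χ.2.1 χ.2.2]
          rfl
        simp only [this, Finset.sum_add_distrib, neg_add]
      map_smul' c ψ := by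
        have : ∀ m, divFunctional (g m) (F m)
            (homotopyOp φ m ((c • ψ : testSpace (Space d)) : Space d → ℝ)) =
            c * divFunctional (g m) (F m) (homotopyOp φ m ψ) := fun m => by
          rw [← divFunctional_const_mul (contDiff_homotopyOp hφ hφc m ψ.2.1 ψ.2.2),
            ← homotopyOp_const_mul]
          rfl
        simp only [this, ← Finset.mul_sum, RingHom.id_apply, smul_eq_mul, mul_neg] }
  choose C₀ hC₀ using fun m : Fin d => exists_integral_sq_radialAverage_le
    (contDiff_coord_mul hφ m) (hasCompactSupport_coord_mul hφc m)
  choose C₁ hC₁ using fun m l : Fin d => exists_integral_sq_fderiv_radialAverage_le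
    (contDiff_coord_mul hφ m) (hasCompactSupport_coord_mul hφc m) (EuclideanSpace.single l 1)
  have hsqrt : ∀ {a b C : ℝ}, a ≤ C ^ 2 * b → √a ≤ |C| * √b := fun {a b C} h => by
    rw [← Real.sqrt_sq_eq_abs, ← Real.sqrt_mul (sq_nonneg C)]
    exact Real.sqrt_le_sqrt h
  obtain ⟨q, hq, hqL⟩ := exists_memLp_forall_eq_integral L
    (∑ m, (√(∫ x, g m x ^ 2) * |C₀ m| + ∑ l, √(∫ x, F m l x ^ 2) * |C₁ m l|)) fun ψ => by
    change |- ∑ m, divFunctional (g m) (F m) (homotopyOp φ m ψ)| ≤ _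
    rw [abs_neg, Finset.sum_mul]
    refine (Finset.abs_sum_le_sum_abs _ _).trans (Finset.sum_le_sum fun m _ => ?_)
    refine (abs_divFunctional_le (hg m) (hF m) (contDiff_homotopyOp hφ hφc m ψ.2.1 ψ.2.2)
      (hasCompactSupport_homotopyOp hφc m ψ.2.2)).trans ?_
    rw [add_mul, Finset.sum_mul]
    refine add_le_add ?_ (Finset.sum_le_sum fun l _ => ?_)
    · rw [mul_assoc]
      exact mul_le_mul_of_nonneg_left (hsqrt (hC₀ m ψ ψ.2.1 ψ.2.2)) (Real.sqrt_nonneg _)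
    · rw [mul_assoc]
      exact mul_le_mul_of_nonneg_left (hsqrt (hC₁ m l ψ ψ.2.1 ψ.2.2)) (Real.sqrt_nonneg _)
  exact ⟨q, hq, fun ψ hψ hψc => (hqL ⟨ψ, hψ, hψc⟩).symm⟩

/-- The convolution of `ψ` and `φ`. -/
def smoothing (φ ψ : Space d → ℝ) : Space d → ℝ :=
  translationAverage volume ψ id φ

theorem contDiff_smoothing (hφ : ContDiff ℝ ∞ φ) (hφc : HasCompactSupport φ) {ψ : Space d → ℝ}
    (hψ : Integrable ψ) : ContDiff ℝ ∞ (smoothing φ ψ) :=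
  contDiff_translationAverage hψ measurable_id hφ hφc

theorem hasCompactSupport_smoothing (hφc : HasCompactSupport φ) {ψ : Space d → ℝ}
    (hψc : HasCompactSupport ψ) : HasCompactSupport (smoothing φ ψ) :=
  hasCompactSupport_translationAverage hφc hψc fun _ ha => subset_tsupport _ ha

theorem pderiv_smoothing (hφ : ContDiff ℝ ∞ φ) (hφc : HasCompactSupport φ) {ψ : Space d → ℝ}
    (hψ : Integrable ψ) (l : Fin d) :
    pderiv l (smoothing φ ψ) = smoothing (pderiv l φ) ψ :=
  funext fun x => fderiv_translationAverage_apply (F := ℝ) hψ measurable_id (hφ.of_le (by simp))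
    hφc x _

theorem integral_mul_comp_sub_eq_smoothing (φ ψ : Space d → ℝ) (x : Space d) :
    ∫ z, φ z * ψ (x - z) = smoothing φ ψ x := by
  rw [smoothing, translationAverage, ← integral_sub_left_eq_self _ volume x]
  simp [mul_comm]

/-- Applying the homotopy functional to `∂ₖ ψ` recovers `-Tₖ`, up to a smoothing term: by
closedness, `∑ₘ Tₘ(Rₘ ∂ₖ ψ) = ∑ₘ Tₘ(∂ₖ Rₘ ψ) = Tₖ(∑ₘ ∂ₘ Rₘ ψ) = Tₖ(ψ - φ * ψ)`. -/
theorem sum_divFunctional_homotopyOp_pderiv {Ω : Set (Space d)} (hg : ∀ k, MemLp (g k) 2)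
    (hF : ∀ k l, MemLp (F k l) 2) (hcl : IsClosedOn Ω g F) (hφ : ContDiff ℝ ∞ φ)
    (hφc : HasCompactSupport φ) (hφ1 : ∫ z, φ z = 1) {ψ : Space d → ℝ} (hψ : ContDiff ℝ ∞ ψ)
    (hψc : HasCompactSupport ψ) (hΩ : tsupport ψ + radialHull φ ⊆ Ω) (k : Fin d) :
    ∑ m, divFunctional (g m) (F m) (homotopyOp φ m (pderiv k ψ)) =
      divFunctional (g k) (F k) ψ - divFunctional (g k) (F k) (smoothing φ ψ) := by
  have hψi := hψ.continuous.integrable_of_hasCompactSupport (μ := volume) hψc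
  have h1 : ∀ m, divFunctional (g m) (F m) (homotopyOp φ m (pderiv k ψ)) =
      divFunctional (g k) (F k) (pderiv m (homotopyOp φ m ψ)) := fun m => by
    rw [← pderiv_homotopyOp hφ hφc m k hψ hψc]
    exact hcl k m _ ⟨contDiff_homotopyOp hφ hφc m hψ hψc, hasCompactSupport_homotopyOp hφc m hψc,
      (tsupport_homotopyOp_subset hφc m hψc).trans hΩ⟩
  simp only [h1]
  rw [← divFunctional_sum (hg k) (hF k) Finset.univ
    (fun m => contDiff_pderiv (contDiff_homotopyOp hφ hφc m hψ hψc) m)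
    (fun m => hasCompactSupport_pderiv (hasCompactSupport_homotopyOp hφc m hψc) m)]
  have h2 : (fun x => ∑ m, pderiv m (homotopyOp φ m ψ) x) =
      fun x => ψ x + (-1) * smoothing φ ψ x := by
    ext x
    rw [sum_pderiv_homotopyOp hφ hφc hφ1 hψ hψc, integral_mul_comp_sub_eq_smoothing]
    ring
  have h3 := contDiff_smoothing hφ hφc hψi
  have h4 := hasCompactSupport_smoothing hφc hψc
  rw [h2, divFunctional_add (hg k) (hF k) hψ hψc (contDiff_const.mul h3) h4.mul_left,
    divFunctional_const_mul h3]
  ring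

end HomotopyFunctional

/-! ### Local primitives -/

section Mollified

open scoped ContDiff Pointwise

variable {d : ℕ} {φ : Space d → ℝ}

/-- The mollification `y ↦ T(φ(· - y))` of the distribution `T = g + ∑ₗ ∂ₗ Fₗ`. -/
def mollified (g : Space d → ℝ) (F : Fin d → Space d → ℝ) (φ : Space d → ℝ) (y : Space d) : ℝ :=
  divFunctional g F fun x => φ (x - y)

theorem pderiv_comp_sub (φ : Space d → ℝ) (y : Space d) (l : Fin d) :
    pderiv l (fun x => φ (x - y)) = fun x => pderiv l φ (x - y) := by
  ext x
  simp only [pderiv, fderiv_comp_sub]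

theorem pderiv_comp_neg (φ : Space d → ℝ) (l : Fin d) :
    pderiv l (fun x => φ (-x)) = fun x => - pderiv l φ (-x) := by
  ext x
  have := (ContinuousLinearEquiv.neg ℝ (M := Space d)).comp_right_fderiv (f := φ) (x := x)
  have h : fderiv ℝ (fun x => φ (-x)) x = (fderiv ℝ φ (-x)).comp
    (ContinuousLinearEquiv.neg ℝ (M := Space d) : Space d →L[ℝ] Space d) := this
  rw [pderiv, h]
  simp [pderiv]

theorem mollified_eq_translationAverage (g : Space d → ℝ) (F : Fin d → Space d → ℝ)
    (φ : Space d → ℝ) : mollified g F φ = fun y =>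
      translationAverage volume g id (fun x => φ (-x)) y -
        ∑ l, translationAverage volume (F l) id (fun x => pderiv l φ (-x)) y := by
  ext y
  simp [mollified, divFunctional, translationAverage, pderiv_comp_sub]

variable {g : Space d → ℝ} {F : Fin d → Space d → ℝ}

theorem hasCompactSupport_comp_neg (hφc : HasCompactSupport φ) :
    HasCompactSupport fun x => φ (-x) :=
  hφc.comp_homeomorph (Homeomorph.neg (Space d))

theorem contDiff_mollified (hg : Integrable g) (hF : ∀ l, Integrable (F l))
    (hφ : ContDiff ℝ ∞ φ) (hφc : HasCompactSupport φ) : ContDiff ℝ ∞ (mollified g F φ) := by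
  rw [mollified_eq_translationAverage]
  refine ContDiff.sub ?_ (ContDiff.sum fun l _ => ?_)
  · exact contDiff_translationAverage hg measurable_id (hφ.comp contDiff_neg)
      (hasCompactSupport_comp_neg hφc)
  · exact contDiff_translationAverage (hF l) measurable_id
      ((contDiff_pderiv hφ l).comp contDiff_neg)
      (hasCompactSupport_comp_neg (hasCompactSupport_pderiv hφc l))

theorem pderiv_mollified (hg : Integrable g) (hF : ∀ l, Integrable (F l))
    (hφ : ContDiff ℝ ∞ φ) (hφc : HasCompactSupport φ) (j : Fin d) (y : Space d) :
    pderiv j (mollified g F φ) y = - mollified g F (pderiv j φ) y := by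
  have key : ∀ {f : Space d → ℝ} {χ : Space d → ℝ}, Integrable f → ContDiff ℝ ∞ χ →
      HasCompactSupport χ → DifferentiableAt ℝ (translationAverage volume f id fun x => χ (-x)) y ∧
        fderiv ℝ (translationAverage volume f id fun x => χ (-x)) y (EuclideanSpace.single j 1) =
          - translationAverage volume f id (fun x => pderiv j χ (-x)) y := by
    intro f χ hf hχ hχc
    have h1 : ContDiff ℝ ∞ fun x => χ (-x) := hχ.comp contDiff_neg
    have h2 := hasCompactSupport_comp_neg hχc
    refine ⟨(contDiff_translationAverage hf measurable_id h1 h2).differentiable (by simp) y, ?_⟩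
    rw [fderiv_translationAverage_apply hf measurable_id (h1.of_le (by simp)) h2]
    have h3 := pderiv_comp_neg χ j
    unfold pderiv at h3
    rw [h3]
    simp [translationAverage, integral_neg, pderiv]
  obtain ⟨hd, he⟩ := key hg hφ hφc
  have hl := fun l => key (hF l) (contDiff_pderiv hφ l) (hasCompactSupport_pderiv hφc l)
  rw [mollified_eq_translationAverage, mollified_eq_translationAverage]
  rw [pderiv, fderiv_fun_sub hd (DifferentiableAt.fun_sum fun l _ => (hl l).1),
    fderiv_fun_sum fun l _ => (hl l).1]
  simp only [sub_apply, sum_apply]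
  rw [he, Finset.sum_congr rfl fun l _ => (hl l).2]
  simp only [pderiv_comm hφ j]
  simp only [pderiv, Finset.sum_neg_distrib]
  ring

theorem integral_mul_smoothing {f ψ : Space d → ℝ} (hf : Integrable f) (hψ : Integrable ψ)
    (hφ : ContDiff ℝ ∞ φ) (hφc : HasCompactSupport φ) :
    ∫ x, f x * smoothing φ ψ x = ∫ y, ψ y * ∫ x, f x * φ (x - y) := by
  have hint : Integrable (fun p : Space d × Space d => f p.1 * ψ p.2 * φ (p.1 - p.2))
      ((volume : Measure (Space d)).prod volume) := by
    obtain ⟨C, hC⟩ := hφc.exists_bound_of_continuous hφ.continuous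
    refine (hf.mul_prod hψ).mul_bdd (c := C) ?_ (Filter.Eventually.of_forall fun p => hC _)
    exact (hφ.continuous.comp (by fun_prop)).aestronglyMeasurable
  calc ∫ x, f x * smoothing φ ψ x = ∫ x, ∫ y, f x * ψ y * φ (x - y) := by
        congr 1
        ext x
        rw [smoothing, translationAverage, ← integral_const_mul]
        simp [mul_assoc]
    _ = ∫ y, ∫ x, f x * ψ y * φ (x - y) := integral_integral_swap hint
    _ = _ := by
        congr 1
        ext y
        rw [← integral_const_mul]
        congr 1
        ext x
        ring

/-- For `T = g + ∑ₗ ∂ₗ Fₗ`, evaluating `T` at `ψ * φ` amounts to integrating `ψ` against the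
mollification of `T`. -/
theorem divFunctional_smoothing (hg : Integrable g) (hF : ∀ l, Integrable (F l))
    (hφ : ContDiff ℝ ∞ φ) (hφc : HasCompactSupport φ) {ψ : Space d → ℝ}
    (hψ : ContDiff ℝ ∞ ψ) (hψc : HasCompactSupport ψ) :
    divFunctional g F (smoothing φ ψ) = ∫ y, ψ y * mollified g F φ y := by
  have hψi := hψ.continuous.integrable_of_hasCompactSupport (μ := volume) hψc
  have hcont : ∀ {f χ : Space d → ℝ}, Integrable f → ContDiff ℝ ∞ χ → HasCompactSupport χ →
      Integrable fun y => ψ y * ∫ x, f x * χ (x - y) := by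
    intro f χ hf hχ hχc
    have h1 : ContDiff ℝ ∞ (translationAverage volume f id fun x => χ (-x)) :=
      contDiff_translationAverage hf measurable_id (hχ.comp contDiff_neg)
        (hasCompactSupport_comp_neg hχc)
    have h2 : (translationAverage volume f id fun x => χ (-x)) = fun y => ∫ x, f x * χ (x - y) := by
      ext y; simp [translationAverage]
    rw [h2] at h1
    exact (hψ.continuous.mul h1.continuous).integrable_of_hasCompactSupport hψc.mul_right
  simp only [divFunctional, mollified, pderiv_smoothing hφ hφc hψi, pderiv_comp_sub]
  rw [integral_mul_smoothing hg hψi hφ hφc]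
  simp only [fun l => integral_mul_smoothing (hF l) hψi (contDiff_pderiv hφ l)
    (hasCompactSupport_pderiv hφc l), mul_sub, Finset.mul_sum]
  have h3 := fun l => hcont (hF l) (contDiff_pderiv hφ l) (hasCompactSupport_pderiv hφc l)
  rw [integral_sub (hcont hg hφ hφc) (integrable_finsetSum _ fun l _ => h3 l),
    integral_finsetSum _ fun l _ => h3 l]

end Mollified

section Patch

open scoped ContDiff Pointwise

variable {d : ℕ}

theorem integrable_mul_of_tsupport_subset {U : Set (Space d)} (hU : IsOpen U) {f ψ : Space d → ℝ}
    (hf : ContinuousOn f U) (hψ : Continuous ψ) (hψc : HasCompactSupport ψ)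
    (hψU : tsupport ψ ⊆ U) : Integrable fun x => f x * ψ x := by
  refine Continuous.integrable_of_hasCompactSupport ?_ hψc.mul_left
  refine continuous_of_tsupport fun x hx => ?_
  have hxU := hψU (tsupport_mul_subset_right hx)
  exact (hf.continuousAt (hU.mem_nhds hxU)).mul hψ.continuousAt

/-- Integration by parts against a test function supported where `f` is differentiable. -/
theorem integral_mul_pderiv_eq {U : Set (Space d)} (hU : IsOpen U) {f : Space d → ℝ}
    {f' : Space d → Space d →L[ℝ] ℝ} (hf : ∀ x ∈ U, HasFDerivAt f (f' x) x)
    (hf' : ContinuousOn f' U) {ψ : Space d → ℝ} (hψ : IsTestFunction U ψ) (k : Fin d) :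
    ∫ x, f x * pderiv k ψ x = - ∫ x, f' x (EuclideanSpace.single k 1) * ψ x := by
  have hfc : ContinuousOn f U := fun x hx => (hf x hx).continuousAt.continuousWithinAt
  have hd : Differentiable ℝ ψ := hψ.1.differentiable (by simp)
  refine integral_bilinear_hasFDerivAt_right_eq_neg_left_of_integrable
    (B := ContinuousLinearMap.mul ℝ ℝ) (f := f) (f' := f') (g := ψ) (g' := fderiv ℝ ψ)
    ?_ ?_ ?_ (fun x hx => hf x (hψ.3 hx)) (fun x _ => (hd x).hasFDerivAt)
  · exact integrable_mul_of_tsupport_subset hU (hf'.clm_apply continuousOn_const)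
      hψ.1.continuous hψ.2 hψ.3
  · exact integrable_mul_of_tsupport_subset hU hfc (contDiff_pderiv hψ.1 k).continuous
      (hψ.pderiv k).2 (hψ.pderiv k).3
  · exact integrable_mul_of_tsupport_subset hU hfc hψ.1.continuous hψ.2 hψ.3

variable {g : Fin d → Space d → ℝ} {F : Fin d → Fin d → Space d → ℝ}

/-- The mollified components of a closed family of distributions have a common primitive on
convex open sets that are translated into `Ω` by the support of the mollifier. -/
theorem exists_primitive_mollified {Ω B : Set (Space d)} (hg : ∀ k, Integrable (g k))
    (hF : ∀ k l, Integrable (F k l)) (hcl : IsClosedOn Ω g F) {φ : Space d → ℝ}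
    (hφ : ContDiff ℝ ∞ φ) (hφc : HasCompactSupport φ) (hB : Convex ℝ B)
    (hBφ : B + tsupport φ ⊆ Ω) :
    ∃ p : Space d → ℝ, ContinuousOn p B ∧ ∀ x ∈ interior B, HasFDerivAt p
      (∑ k, mollified (g k) (F k) φ x • (EuclideanSpace.proj k : Space d →L[ℝ] ℝ)) x := by
  set τ : Fin d → Space d → ℝ := fun k => mollified (g k) (F k) φ
  have hτ : ∀ k, ContDiff ℝ ∞ (τ k) := fun k => contDiff_mollified (hg k) (hF k) hφ hφc
  set η : Space d → Space d →L[ℝ] ℝ := fun x =>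
    ∑ k, τ k x • (EuclideanSpace.proj k : Space d →L[ℝ] ℝ)
  have hη : ∀ x, HasFDerivAt η
      (∑ k, (fderiv ℝ (τ k) x).smulRight
        ((EuclideanSpace.proj k : Space d →L[ℝ] ℝ))) x := fun x => by
    refine HasFDerivAt.fun_sum fun k _ => ?_
    exact ((hτ k).differentiable (by simp) x).hasFDerivAt.smul_const
      (EuclideanSpace.proj k : Space d →L[ℝ] ℝ)
  have hsymm : ∀ x ∈ B, ∀ j k, pderiv j (τ k) x = pderiv k (τ j) x := fun x hx j k => by
    simp only [τ]
    rw [pderiv_mollified (hg k) (hF k) hφ hφc, pderiv_mollified (hg j) (hF j) hφ hφc]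
    simp only [mollified]
    rw [← pderiv_comp_sub, ← pderiv_comp_sub, hcl j k]
    refine ⟨hφ.comp (contDiff_id.sub contDiff_const),
      hφc.comp_homeomorph (Homeomorph.subRight x), fun y hy => hBφ ?_⟩
    have : y - x ∈ tsupport φ :=
      tsupport_comp_subset_preimage φ (f := fun y => y - x) (by fun_prop) hy
    exact ⟨x, hx, y - x, this, by simp⟩
  obtain ⟨p, hp⟩ := hB.exists_forall_hasFDerivWithinAt_of_hasFDerivWithinAt_symmetric
    (fun x _ => (hη x).hasFDerivWithinAt (s := B)) fun x hx u _ v _ => by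
      simp only [sum_apply, ContinuousLinearMap.smulRight_apply,
        smul_apply, PiLp.proj_apply, smul_eq_mul,
        fderiv_eq_sum_pderiv, Finset.sum_mul]
      rw [Finset.sum_comm]
      refine Finset.sum_congr rfl fun j _ => Finset.sum_congr rfl fun k _ => ?_
      rw [hsymm x hx j k]
      ring
  exact ⟨p, fun x hx => (hp x hx).continuousWithinAt, fun x hx =>
    (hp x (interior_subset hx)).hasFDerivAt (mem_interior_iff_mem_nhds.1 hx)⟩

/-- On the part `U` of `Ω` in a ball, a closed family of distributions has a square integrable
primitive, provided that `U` can be moved inside `Ω` along the segments from the origin to the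
support of a mollifier `φ`, and that the whole ball is translated into `Ω` by this support. -/
theorem exists_primitive_of_mollifier {Ω : Set (Space d)} (hg : ∀ k, MemLp (g k) 2)
    (hg' : ∀ k, Integrable (g k)) (hF : ∀ k l, MemLp (F k l) 2) (hF' : ∀ k l, Integrable (F k l))
    (hcl : IsClosedOn Ω g F) {φ : Space d → ℝ}
    (hφ : ContDiff ℝ ∞ φ) (hφc : HasCompactSupport φ) (hφ1 : ∫ z, φ z = 1) {x₀ : Space d} {r : ℝ}
    (hr : 0 < r)
    (hseg : Ω ∩ Metric.ball x₀ r + radialHull φ ⊆ Ω)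
    (hball : Metric.closedBall x₀ r + tsupport φ ⊆ Ω) :
    ∃ q : Space d → ℝ, MemLp q 2 (volume.restrict (Metric.ball x₀ r)) ∧
      IsPrimitiveOn (Ω ∩ Metric.ball x₀ r) q g F := by
  obtain ⟨q, hq, hqL⟩ := exists_memLp_homotopy hg hF hφ hφc
  obtain ⟨p, hpc, hp⟩ := exists_primitive_mollified hg' hF' hcl hφ hφc
    (convex_closedBall x₀ r) hball
  rw [interior_closedBall x₀ hr.ne'] at hp
  refine ⟨fun x => p x + q x, MemLp.add ?_ (hq.restrict _), fun k ψ hψ => ?_⟩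
  · have hcpt := isCompact_closedBall x₀ r
    obtain ⟨C, hC⟩ := hcpt.exists_bound_of_continuousOn hpc
    have : IsFiniteMeasure (volume.restrict (Metric.closedBall x₀ r)) :=
      ⟨by simpa using hcpt.measure_lt_top⟩
    have hm : MemLp p 2 (volume.restrict (Metric.closedBall x₀ r)) :=
      MemLp.of_bound (hpc.aestronglyMeasurable measurableSet_closedBall) C
        (ae_restrict_of_forall_mem measurableSet_closedBall hC)
    exact hm.mono_measure (Measure.restrict_mono Metric.ball_subset_closedBall le_rfl)
  · have hψB : tsupport ψ ⊆ Metric.ball x₀ r := hψ.3.trans Set.inter_subset_right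
    have h1 := integral_mul_pderiv_eq Metric.isOpen_ball hp
      (by
        refine Continuous.continuousOn (continuous_finsetSum _ fun k _ => ?_)
        exact (contDiff_mollified (hg' k) (hF' k) hφ hφc).continuous.smul continuous_const)
      ⟨hψ.1, hψ.2, hψB⟩ k
    have h2 : ∀ x, (∑ j, mollified (g j) (F j) φ x • (EuclideanSpace.proj j : Space d →L[ℝ] ℝ) :
        Space d →L[ℝ] ℝ) (EuclideanSpace.single k 1) * ψ x =
        ψ x * mollified (g k) (F k) φ x := fun x => by
      simp [mul_comm]
    simp only [h2] at h1
    rw [← divFunctional_smoothing (hg' k) (hF' k) hφ hφc hψ.1 hψ.2] at h1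
    have h3 := hqL _ (contDiff_pderiv hψ.1 k) (hasCompactSupport_pderiv hψ.2 k)
    rw [sum_divFunctional_homotopyOp_pderiv hg hF hcl hφ hφc hφ1 hψ.1 hψ.2
      ((Set.add_subset_add_right hψ.3).trans hseg) k] at h3
    simp only [add_mul]
    rw [integral_add, h1, h3]
    · ring
    · exact integrable_mul_of_tsupport_subset Metric.isOpen_ball
        (fun x hx => (hp x hx).continuousAt.continuousWithinAt) (contDiff_pderiv hψ.1 k).continuous
        (hψ.pderiv k).2 ((tsupport_pderiv_subset ψ k).trans hψB)
    · exact integrable_mul_of_memLp hq (contDiff_pderiv hψ.1 k) (hasCompactSupport_pderiv hψ.2 k)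

end Patch

/-! ### Gluing locally constant functions -/

section Gluing

open Filter Topology

/-- On a simply connected space, every Čech cocycle of locally constant functions with values in
an abelian group is a coboundary. The cocycle defines a fibre bundle with discrete fibre, which is
a covering and thus has a section. -/
theorem exists_coboundary {X ι G : Type*} [TopologicalSpace X] [SimplyConnectedSpace X]
    [LocallyPathConnectedSpace X] [AddCommGroup G] {U : ι → Set X} (hU : ∀ i, IsOpen (U i))
    (hcov : ∀ x, ∃ i, x ∈ U i) (c : ι → ι → X → G)
    (hc : ∀ i j, ∀ x ∈ U i ∩ U j, ∀ᶠ y in 𝓝 x, c i j y = c i j x)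
    (hcoc : ∀ i j k, ∀ x ∈ U i ∩ U j ∩ U k, c i j x + c j k x = c i k x) :
    ∃ b : ι → X → G, (∀ i, ∀ x ∈ U i, ∀ᶠ y in 𝓝 x, b i y = b i x) ∧
      ∀ i j, ∀ x ∈ U i ∩ U j, b j x = b i x + c i j x := by
  let : TopologicalSpace G := ⊥
  have : DiscreteTopology G := ⟨rfl⟩
  choose idx hidx using hcov
  let Z : FiberBundleCore ι X G :=
    { baseSet := U
      isOpen_baseSet := hU
      indexAt := idx
      mem_baseSet_at := hidx
      coordChange i j x v := v + c i j x
      coordChange_self i x hx v := by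
        have := hcoc i i i x ⟨⟨hx, hx⟩, hx⟩
        simpa using this
      continuousOn_coordChange i j := by
        rintro ⟨x, v⟩ ⟨hx, -⟩
        refine ContinuousAt.continuousWithinAt ?_
        have h : (fun p : X × G => p.2 + c i j p.1) =ᶠ[𝓝 (x, v)] fun _ => v + c i j x := by
          rw [nhds_prod_eq, nhds_discrete G]
          filter_upwards [prod_mem_prod (hc i j x hx) (mem_pure.2 (Set.mem_singleton v))] with p hp
          rw [hp.1, hp.2]
        exact continuousAt_const.congr h.symm
      coordChange_comp i j k x hx v := by
        rw [add_assoc, hcoc i j k x hx] }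
  have hcovering : IsCoveringMap (Bundle.TotalSpace.proj : Z.TotalSpace → X) :=
    FiberBundle.isCoveringMap
  obtain ⟨x₀⟩ : Nonempty X := inferInstance
  obtain ⟨s, ⟨-, hs⟩, -⟩ := hcovering.existsUnique_continuousMap_lifts (ContinuousMap.id X) x₀
    (⟨x₀, (0 : G)⟩ : Z.TotalSpace) rfl
  have hsx : ∀ x, (s x).1 = x := fun x => congrFun hs x
  refine ⟨fun i x => (Z.localTriv i (s x)).2, fun i x hx => ?_, fun i j x hx => ?_⟩
  · have h1 : ContinuousAt (fun y => (Z.localTriv i (s y)).2) x := by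
      refine continuousAt_snd.comp
        (ContinuousAt.comp (g := Z.localTriv i) ?_ s.continuous.continuousAt)
      refine (Z.localTriv i).continuousAt ?_
      rw [FiberBundleCore.mem_localTriv_source, hsx]
      exact hx
    have := h1.tendsto
    rw [nhds_discrete G, tendsto_pure] at this
    exact this
  · have h2 := Z.coordChange_comp (idx x) i j x ⟨⟨hidx x, hx.1⟩, hx.2⟩ (s x).2
    have h3 : ∀ i, (Z.localTriv i (s x)).2 = Z.coordChange (idx x) i x (s x).2 := fun i => by
      change Z.coordChange (idx (s x).1) i (s x).1 (s x).2 = _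
      rw [hsx]
    beta_reduce
    rw [h3, h3]
    exact h2.symm

end Gluing

/-! ### Functions with vanishing weak gradient -/

section Uniqueness

open scoped ContDiff Pointwise
open Filter Topology

variable {d : ℕ}

/-- A mollifier supported in a given ball. -/
theorem exists_mollifier (v : Space d) {ρ : ℝ} (hρ : 0 < ρ) :
    ∃ φ : Space d → ℝ, ContDiff ℝ ∞ φ ∧ HasCompactSupport φ ∧ ∫ z, φ z = 1 ∧
      tsupport φ ⊆ Metric.closedBall v ρ := by
  let f : ContDiffBump v := ⟨ρ / 2, ρ, by positivity, by linarith⟩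
  refine ⟨f.normed volume, f.contDiff_normed, f.hasCompactSupport_normed, f.integral_normed, ?_⟩
  rw [f.tsupport_normed_eq]

theorem integrable_mul_testFunction {h ψ : Space d → ℝ} (hh : Integrable h) (hψ : Continuous ψ)
    (hψc : HasCompactSupport ψ) : Integrable fun x => h x * ψ x := by
  obtain ⟨C, hC⟩ := hψc.exists_bound_of_continuous hψ
  exact hh.mul_bdd (c := C) hψ.aestronglyMeasurable (Eventually.of_forall hC)

/-- By the homotopy formula, a function with vanishing weak gradient coincides with its
mollification, which is constant. -/
theorem ae_eq_const_of_integral_pderiv_eq_zero {h : Space d → ℝ} (hh : Integrable h)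
    {x₀ : Space d} {ε : ℝ} (hε : 0 < ε)
    (hz : ∀ k ψ, IsTestFunction (Metric.ball x₀ (3 * ε)) ψ → ∫ x, h x * pderiv k ψ x = 0) :
    ∃ c, ∀ᵐ x, x ∈ Metric.ball x₀ ε → h x = c := by
  obtain ⟨φ, hφ, hφc, hφ1, hφs⟩ := exists_mollifier (0 : Space d) hε
  set τ := mollified h (fun _ _ => 0) φ with hτdef
  have hτ : ∀ y, τ y = ∫ x, h x * φ (x - y) := fun y => by simp [τ, mollified, divFunctional]
  have hτs : ContDiff ℝ ∞ τ := contDiff_mollified hh (fun _ => integrable_zero _ _ _) hφ hφc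
  have hτd : ∀ y ∈ Metric.ball x₀ ε, fderiv ℝ τ y = 0 := fun y hy => by
    ext z
    rw [fderiv_eq_sum_pderiv]
    refine Finset.sum_eq_zero fun j _ => ?_
    rw [hτdef, pderiv_mollified (F := fun _ _ => 0) hh (fun _ => integrable_zero _ _ _) hφ hφc,
      mollified, ← pderiv_comp_sub]
    have : IsTestFunction (Metric.ball x₀ (3 * ε)) fun x => φ (x - y) := by
      refine ⟨hφ.comp (contDiff_id.sub contDiff_const),
        hφc.comp_homeomorph (Homeomorph.subRight y), fun x hx => ?_⟩
      have hx' : x - y ∈ tsupport φ :=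
        tsupport_comp_subset_preimage φ (f := fun x => x - y) (by fun_prop) hx
      have h1 := hφs hx'
      rw [mem_closedBall_zero_iff] at h1
      rw [mem_ball_iff_norm] at hy ⊢
      calc ‖x - x₀‖ = ‖(x - y) + (y - x₀)‖ := by congr 1; abel
        _ ≤ _ := norm_add_le _ _
        _ < _ := by linarith
    simp [divFunctional, hz j _ this]
  have hτc : ∀ y ∈ Metric.ball x₀ ε, τ y = τ x₀ := fun y hy =>
    (convex_ball x₀ ε).is_const_of_fderivWithin_eq_zero
      (fun z _ => (hτs.differentiable (by simp) z).differentiableWithinAt)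
      (fun z hz => by
        rw [fderivWithin_of_isOpen Metric.isOpen_ball hz]; exact hτd z hz)
      hy (Metric.mem_ball_self hε)
  refine ⟨τ x₀, ?_⟩
  have key : ∀ᵐ x, x ∈ Metric.ball x₀ ε → h x - τ x₀ = 0 := by
    refine Metric.isOpen_ball.ae_eq_zero_of_integral_contDiff_smul_eq_zero
      ((hh.locallyIntegrable.sub (locallyIntegrable_const _)).locallyIntegrableOn _)
      fun ψ hψ hψc hψs => ?_
    have hψi := hψ.continuous.integrable_of_hasCompactSupport (μ := volume) hψc
    have h1 : ∫ x, h x * ∑ m, pderiv m (homotopyOp φ m ψ) x = 0 := by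
      simp only [Finset.mul_sum]
      rw [integral_finsetSum _ fun m _ => integrable_mul_testFunction hh
        (contDiff_pderiv (contDiff_homotopyOp hφ hφc m hψ hψc) m).continuous
        (hasCompactSupport_pderiv (hasCompactSupport_homotopyOp hφc m hψc) m)]
      refine Finset.sum_eq_zero fun m _ => hz m _ ⟨contDiff_homotopyOp hφ hφc m hψ hψc,
        hasCompactSupport_homotopyOp hφc m hψc, ?_⟩
      refine (tsupport_homotopyOp_subset hφc m hψc).trans ?_
      rintro _ ⟨y, hy, _, ⟨⟨s, z⟩, ⟨hs, hz⟩, rfl⟩, rfl⟩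
      have hy := hψs hy
      have hz := hφs hz
      rw [mem_closedBall_zero_iff] at hz
      rw [mem_ball_iff_norm] at hy ⊢
      have hsz : ‖s • z‖ ≤ ε := by
        rw [norm_smul, Real.norm_of_nonneg hs.1]
        exact (mul_le_of_le_one_left (norm_nonneg _) hs.2).trans hz
      calc ‖y + s • z - x₀‖ = ‖(y - x₀) + s • z‖ := by congr 1; abel
        _ ≤ _ := norm_add_le _ _
        _ < _ := by linarith
    have h2 : ∫ x, h x * ψ x = ∫ x, h x * smoothing φ ψ x := by
      simp only [sum_pderiv_homotopyOp hφ hφc hφ1 hψ hψc, integral_mul_comp_sub_eq_smoothing,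
        mul_sub] at h1
      rw [integral_sub (integrable_mul_testFunction hh hψ.continuous hψc)
        (integrable_mul_testFunction hh (contDiff_smoothing hφ hφc hψi).continuous
          (hasCompactSupport_smoothing hφc hψc))] at h1
      linarith
    rw [integral_mul_smoothing hh hψi hφ hφc] at h2
    have h3 : ∀ y, ψ y * ∫ x, h x * φ (x - y) = ψ y * τ x₀ := fun y => by
      by_cases hy : y ∈ tsupport ψ
      · rw [← hτ, hτc y (hψs hy)]
      · rw [image_eq_zero_of_notMem_tsupport hy]; simp
    simp only [h3] at h2
    simp only [smul_eq_mul, mul_sub]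
    rw [integral_sub _ (hψi.mul_const _), ← h2]
    · simp [mul_comm]
    · simpa only [mul_comm] using integrable_mul_testFunction hh hψ.continuous hψc
  filter_upwards [key] with x hx hxb
  linarith [hx hxb]

/-- A function with vanishing weak gradient on an open set is almost everywhere equal to a locally
constant function there. -/
theorem exists_locallyConstant_of_integral_pderiv_eq_zero {V : Set (Space d)} (hV : IsOpen V)
    {h : Space d → ℝ} (hh : Integrable h)
    (hz : ∀ k ψ, IsTestFunction V ψ → ∫ x, h x * pderiv k ψ x = 0) :
    ∃ c : Space d → ℝ, (∀ x ∈ V, ∀ᶠ y in 𝓝 x, c y = c x) ∧ ∀ᵐ x, x ∈ V → h x = c x := by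
  have h1 : ∀ x : V, ∃ ε > 0, Metric.ball (x : Space d) ε ⊆ V ∧
      ∃ c, ∀ᵐ y, y ∈ Metric.ball (x : Space d) ε → h y = c := fun x => by
    obtain ⟨δ, hδ, hδV⟩ := Metric.isOpen_iff.1 hV x x.2
    refine ⟨δ / 3, by positivity, (Metric.ball_subset_ball (by linarith)).trans hδV, ?_⟩
    refine ae_eq_const_of_integral_pderiv_eq_zero hh (by positivity) fun k ψ hψ => ?_
    refine hz k ψ ⟨hψ.1, hψ.2, hψ.3.trans ?_⟩
    rwa [show 3 * (δ / 3) = δ by ring]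
  choose ε hε hεV C hC using h1
  classical
  have hconst : ∀ x y : V, (y : Space d) ∈ Metric.ball (x : Space d) (ε x) → C y = C x := by
    intro x y hy
    have hne : (Metric.ball (x : Space d) (ε x) ∩ Metric.ball (y : Space d) (ε y)).Nonempty :=
      ⟨y, hy, Metric.mem_ball_self (hε y)⟩
    have hpos := (Metric.isOpen_ball.inter Metric.isOpen_ball).measure_pos volume hne
    obtain ⟨z, hz, hz1, hz2⟩ := ((frequently_ae_mem_iff.2 hpos.ne').and_eventually
      ((hC x).and (hC y))).exists
    rw [← hz1 hz.1, ← hz2 hz.2]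
  refine ⟨fun x => if hx : x ∈ V then C ⟨x, hx⟩ else 0, fun x hx => ?_, ?_⟩
  · filter_upwards [Metric.ball_mem_nhds x (hε ⟨x, hx⟩)] with y hy
    rw [dif_pos hx, dif_pos (hεV ⟨x, hx⟩ hy)]
    exact hconst ⟨x, hx⟩ ⟨y, _⟩ hy
  · rw [ae_iff]
    refine measure_null_of_locally_null _ fun x hx => ?_
    have hxV : x ∈ V := by
      by_contra hcon
      exact hx fun hx' => absurd hx' hcon
    refine ⟨Metric.ball x (ε ⟨x, hxV⟩) ∩ _, Filter.inter_mem (mem_nhdsWithin_of_mem_nhds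
      (Metric.ball_mem_nhds x (hε ⟨x, hxV⟩))) self_mem_nhdsWithin, ?_⟩
    refine measure_mono_null (fun y hy => ?_) (ae_iff.1 (hC ⟨x, hxV⟩))
    intro hcon
    refine hy.2 fun hyV => ?_
    rw [hcon hy.1]
    beta_reduce
    rw [dif_pos hyV]
    exact (hconst ⟨x, hxV⟩ ⟨y, hyV⟩ hy.1).symm

end Uniqueness

/-! ### Cone patches of a Lipschitz domain -/

section Geometry

variable {d : ℕ}

/-- Translations along `closedBall v ρ` are admissible near `x₀`: they push the points of `Ω` in
`ball x₀ r` along segments of `Ω`, they push the whole of `closedBall x₀ r` into `Ω`, and in both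
cases the result stays in `ball x₀ R`. -/
structure IsPatch (Ω : Set (Space d)) (x₀ : Space d) (R r : ℝ) (v : Space d) (ρ : ℝ) : Prop where
  radius_pos : 0 < r
  width_pos : 0 < ρ
  radius_le : r ≤ R
  segment_mem : ∀ y ∈ Ω ∩ Metric.ball x₀ r, ∀ s ∈ Set.Icc (0 : ℝ) 1, ∀ z ∈ Metric.closedBall v ρ,
    y + s • z ∈ Ω ∩ Metric.ball x₀ R
  translate_mem : ∀ y ∈ Metric.closedBall x₀ r, ∀ z ∈ Metric.closedBall v ρ,
    y + z ∈ Ω ∩ Metric.ball x₀ R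

theorem exists_isPatch_of_mem {Ω : Set (Space d)} (hΩ : IsOpen Ω) {x₀ : Space d} (hx₀ : x₀ ∈ Ω)
    {R : ℝ} (hR : 0 < R) : ∃ r v ρ, IsPatch Ω x₀ R r v ρ := by
  obtain ⟨ε, hε, hεΩ⟩ := Metric.isOpen_iff.1 hΩ x₀ hx₀
  set t := min ε R with ht
  have ht0 : 0 < t := lt_min hε hR
  have hmem : ∀ y : Space d, ‖y - x₀‖ < t → y ∈ Ω ∩ Metric.ball x₀ R := fun y hy =>
    ⟨hεΩ (mem_ball_iff_norm.2 (hy.trans_le (min_le_left _ _))),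
      mem_ball_iff_norm.2 (hy.trans_le (min_le_right _ _))⟩
  refine ⟨t / 4, 0, t / 4, by positivity, by positivity, by linarith [min_le_right ε R],
    fun y hy s hs z hz => hmem _ ?_, fun y hy z hz => hmem _ ?_⟩
  · have h1 := mem_ball_iff_norm.1 hy.2
    have h2 : ‖z‖ ≤ t / 4 := by simpa using hz
    have h3 : ‖s • z‖ ≤ ‖z‖ := by
      rw [norm_smul, Real.norm_of_nonneg hs.1]
      exact mul_le_of_le_one_left (norm_nonneg _) hs.2
    rw [add_sub_right_comm]
    linarith [norm_add_le (y - x₀) (s • z)]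
  · have h1 := mem_closedBall_iff_norm.1 hy
    have h2 : ‖z‖ ≤ t / 4 := by simpa using hz
    rw [add_sub_right_comm]
    linarith [norm_add_le (y - x₀) z]

/-- Near a boundary point the domain lies strictly above the graph of a Lipschitz function, so
vectors close to the vertical direction `ν` are admissible translations. -/
theorem exists_isPatch {Ω : Set (Space d)} (hΩ : IsOpen Ω) (hlip : HasLipschitzBoundary Ω)
    {x₀ : Space d} (hx₀ : x₀ ∈ closure Ω) {R : ℝ} (hR : 0 < R) :
    ∃ r v ρ, IsPatch Ω x₀ R r v ρ := by
  by_cases hxΩ : x₀ ∈ Ω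
  · exact exists_isPatch_of_mem hΩ hxΩ hR
  obtain ⟨r₀, hr₀, ν, hν, K, γ, hγ, hgraph⟩ := hlip x₀ (by
    rw [frontier, hΩ.interior_eq]; exact ⟨hx₀, hxΩ⟩)
  set P := (Submodule.span ℝ {ν})ᗮ.orthogonalProjectionOnto with hP
  have hPν : P ν = 0 := Submodule.orthogonalProjectionOnto_orthogonalComplement_singleton_eq_zero ν
  have hPle : ∀ z, ‖P z‖ ≤ ‖z‖ := fun z => Submodule.norm_orthogonalProjectionOnto_apply_le _ z
  have hγP : ∀ y y', γ (P y) ≤ γ (P y') + K * ‖P (y - y')‖ := fun y y' => by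
    have := hγ.dist_le_mul (P y) (P y')
    rw [Real.dist_eq, dist_eq_norm, ← map_sub] at this
    linarith [le_abs_self (γ (P y) - γ (P y'))]
  have hinner : ∀ z, -‖z‖ ≤ ⟪ν, z⟫ := fun z => by
    have := abs_real_inner_le_norm ν z
    rw [hν, one_mul] at this
    exact (abs_le.1 this).1
  have hνν : ⟪ν, ν⟫ = (1 : ℝ) := by rw [real_inner_self_eq_norm_sq, hν, one_pow]
  have hx₀γ : γ (P x₀) ≤ ⟪ν, x₀⟫ := by
    have hcl : IsClosed {y : Space d | γ (P y) ≤ ⟪ν, y⟫} :=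
      isClosed_le (hγ.continuous.comp P.continuous) (by fun_prop)
    refine closure_minimal (fun y hy => ?_) hcl
      (Metric.isOpen_ball.inter_closure ⟨Metric.mem_ball_self hr₀, hx₀⟩)
    exact ((hgraph y hy.1).1 hy.2).le
  set t := min r₀ R with ht
  have ht0 : 0 < t := lt_min hr₀ hR
  set h := t / 2 with hh
  have hh0 : 0 < h := by positivity
  have hK : (0 : ℝ) ≤ K := K.2
  -- A direction error or displacement of size `ρ` changes the height above the graph by at most
  -- `(K + 1) ρ = h / 4`, while a translation by `h • ν` raises it by `h`.
  set ρ := h / (4 * (K + 1)) with hρ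
  have hρ0 : 0 < ρ := by positivity
  have hKρ : (K + 1) * ρ = h / 4 := by rw [hρ]; field_simp
  have hKρ0 : 0 ≤ K * ρ := by positivity
  have hmem : ∀ y : Space d, ‖y - x₀‖ < t → γ (P y) < ⟪ν, y⟫ → y ∈ Ω ∩ Metric.ball x₀ R :=
    fun y hy hy' => ⟨(hgraph y (mem_ball_iff_norm.2 (hy.trans_le (min_le_left _ _)))).2 hy',
      mem_ball_iff_norm.2 (hy.trans_le (min_le_right _ _))⟩
  have hPz : ∀ z, ‖z - h • ν‖ ≤ ρ → ‖P z‖ ≤ ρ := fun z hz => by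
    have := hPle (z - h • ν)
    rw [map_sub, map_smul, hPν, smul_zero, sub_zero] at this
    exact this.trans hz
  have hνz : ∀ z, ‖z - h • ν‖ ≤ ρ → h - ρ ≤ ⟪ν, z⟫ := fun z hz => by
    have := hinner (z - h • ν)
    rw [inner_sub_right, inner_smul_right, hνν] at this
    linarith
  have hnz : ∀ z, ‖z - h • ν‖ ≤ ρ → ‖z‖ ≤ h + ρ := fun z hz => by
    have := norm_add_le (z - h • ν) (h • ν)
    rw [sub_add_cancel, norm_smul, hν, Real.norm_of_nonneg hh0.le] at this
    linarith
  refine ⟨ρ, h • ν, ρ, hρ0, hρ0, by linarith [min_le_right r₀ R], fun y hy s hs z hz => ?_,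
    fun y hy z hz => ?_⟩
  · have h1 := mem_ball_iff_norm.1 hy.2
    have hz' := mem_closedBall_iff_norm.1 hz
    have h3 : ‖s • z‖ ≤ ‖z‖ := by
      rw [norm_smul, Real.norm_of_nonneg hs.1]
      exact mul_le_of_le_one_left (norm_nonneg _) hs.2
    have hyr : y ∈ Metric.ball x₀ r₀ :=
      mem_ball_iff_norm.2 (h1.trans (by linarith [min_le_left r₀ R]))
    refine hmem _ ?_ ?_
    · rw [add_sub_right_comm]
      linarith [norm_add_le (y - x₀) (s • z), hnz z hz']
    · have h4 := (hgraph y hyr).1 hy.1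
      have h5 := hγP (y + s • z) y
      rw [add_sub_cancel_left, map_smul, norm_smul, Real.norm_of_nonneg hs.1] at h5
      rw [inner_add_right, inner_smul_right]
      have h6 : K * (s * ‖P z‖) ≤ s * (K * ρ) := by
        rw [mul_left_comm]
        exact mul_le_mul_of_nonneg_left (mul_le_mul_of_nonneg_left (hPz z hz') hK) hs.1
      have h7 : s * (K * ρ) ≤ s * ⟪ν, z⟫ :=
        mul_le_mul_of_nonneg_left (by linarith [hνz z hz']) hs.1
      linarith
  · have h1 := mem_closedBall_iff_norm.1 hy
    have hz' := mem_closedBall_iff_norm.1 hz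
    refine hmem _ ?_ ?_
    · rw [add_sub_right_comm]
      linarith [norm_add_le (y - x₀) z, hnz z hz']
    · have h5 := hγP (y + z) x₀
      have h6 : ‖P (y + z - x₀)‖ ≤ ρ + ρ := by
        rw [add_sub_right_comm, map_add]
        exact (norm_add_le _ _).trans (add_le_add ((hPle _).trans h1) (hPz z hz'))
      have h7 : K * ‖P (y + z - x₀)‖ ≤ K * (ρ + ρ) := mul_le_mul_of_nonneg_left h6 hK
      have h8 := hinner (y - x₀)
      rw [inner_sub_right] at h8
      rw [inner_add_right]
      linarith [hνz z hz']

end Geometry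

/-! ### The Poincaré lemma for square integrable primitives -/

section PoincareLemma

open scoped ContDiff Pointwise Topology Manifold
open Filter

variable {d : ℕ}

/-- Locally constant functions on an open set that agree almost everywhere agree everywhere. -/
theorem eq_of_ae_eq_of_eventually_eq {V : Set (Space d)} (hV : IsOpen V) {f f' : Space d → ℝ}
    (hf : ∀ x ∈ V, ∀ᶠ y in 𝓝 x, f y = f x) (hf' : ∀ x ∈ V, ∀ᶠ y in 𝓝 x, f' y = f' x)
    (hae : ∀ᵐ x, x ∈ V → f x = f' x) {x : Space d} (hx : x ∈ V) : f x = f' x := by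
  have hmem : V ∩ {y | f y = f x} ∩ {y | f' y = f' x} ∈ 𝓝 x :=
    inter_mem (inter_mem (hV.mem_nhds hx) (hf x hx)) (hf' x hx)
  obtain ⟨y, ⟨⟨hyV, h1⟩, h2⟩, h3⟩ := ((frequently_ae_mem_iff (μ := volume)).2
    (Measure.measure_pos_of_mem_nhds volume hmem).ne').and_eventually hae |>.exists
  rw [← show f y = f x from h1, ← show f' y = f' x from h2, h3 hyV]

/-- The form of `exists_coboundary` for functions on an ambient space. -/
theorem exists_coboundary_of_isOpen {Ω : Set (Space d)} (hΩ : IsOpen Ω) [SimplyConnectedSpace Ω]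
    {ι : Type*} {U : ι → Set (Space d)} (hU : ∀ i, IsOpen (U i)) (hUΩ : ∀ i, U i ⊆ Ω)
    (hcov : Ω ⊆ ⋃ i, U i) (c : ι → ι → Space d → ℝ)
    (hc : ∀ i j, ∀ x ∈ U i ∩ U j, ∀ᶠ y in 𝓝 x, c i j y = c i j x)
    (hcoc : ∀ i j k, ∀ x ∈ U i ∩ U j ∩ U k, c i j x + c j k x = c i k x) :
    ∃ b : ι → Space d → ℝ, (∀ i, ∀ x ∈ U i, ∀ᶠ y in 𝓝 x, b i y = b i x) ∧
      ∀ i j, ∀ x ∈ U i ∩ U j, b j x = b i x + c i j x := by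
  have : LocallyPathConnectedSpace Ω := hΩ.locallyPathConnectedSpace
  obtain ⟨b, hb, hbc⟩ := exists_coboundary (X := Ω) (U := fun i => Subtype.val ⁻¹' U i)
    (fun i => (hU i).preimage continuous_subtype_val)
    (fun x => by simpa using hcov x.2) (fun i j x => c i j x)
    (fun i j x hx => continuous_subtype_val.continuousAt.eventually (hc i j x hx))
    (fun i j k x hx => hcoc i j k x hx)
  classical
  refine ⟨fun i y => if hy : y ∈ Ω then b i ⟨y, hy⟩ else 0, fun i x hx => ?_,
    fun i j x hx => ?_⟩
  · have h := hb i ⟨x, hUΩ i hx⟩ hx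
    rw [← hΩ.isOpenEmbedding_subtypeVal.map_nhds_eq ⟨x, hUΩ i hx⟩, eventually_map]
    filter_upwards [h] with y hy
    simpa [hUΩ i hx] using hy
  · have hxΩ := hUΩ i hx.1
    simpa [hxΩ] using hbc i j ⟨x, hxΩ⟩ hx

theorem hasFDerivAt_zero_of_eventually_eq {f : Space d → ℝ} {x : Space d}
    (hf : ∀ᶠ y in 𝓝 x, f y = f x) : HasFDerivAt f (0 : Space d →L[ℝ] ℝ) x :=
  (hasFDerivAt_const (f x) x).congr_of_eventuallyEq hf

/-- A locally constant function takes no other values on a patch than on its translate by `v`,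
which is relatively compact in `Ω`. -/
theorem IsPatch.exists_bound {Ω : Set (Space d)} {x₀ v : Space d} {R r ρ : ℝ}
    (hp : IsPatch Ω x₀ R r v ρ) {b : Space d → ℝ}
    (hb : ∀ x ∈ Ω ∩ Metric.ball x₀ R, ∀ᶠ y in 𝓝 x, b y = b x) :
    ∃ C, ∀ y ∈ Ω ∩ Metric.ball x₀ r, ‖b y‖ ≤ C := by
  have hv : v ∈ Metric.closedBall v ρ := Metric.mem_closedBall_self hp.width_pos.le
  have hc : ContinuousOn (fun y => b (y + v)) (Metric.closedBall x₀ r) := fun y hy => by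
    have h1 := (hasFDerivAt_zero_of_eventually_eq (hb _ (hp.translate_mem y hy v hv))).continuousAt
    exact (h1.comp (f := fun y => y + v) (by fun_prop)).continuousWithinAt
  obtain ⟨C, hC⟩ := (isCompact_closedBall x₀ r).exists_bound_of_continuousOn hc
  refine ⟨C, fun y hy => ?_⟩
  have hd : ∀ s ∈ Set.Icc (0 : ℝ) 1, HasDerivAt (fun s : ℝ => b (y + s • v)) 0 s := fun s hs => by
    have h1 := hasFDerivAt_zero_of_eventually_eq (hb _ (hp.segment_mem y hy s hs v hv))
    have h2 : HasDerivAt (fun s : ℝ => y + s • v) ((1 : ℝ) • v) s :=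
      ((hasDerivAt_id s).smul_const v).const_add y
    have h3 := h1.comp_hasDerivAt s h2
    rwa [zero_apply] at h3
  have h := constant_of_has_deriv_right_zero
    (fun s hs => (hd s hs).continuousAt.continuousWithinAt)
    (fun s hs => (hd s (Set.Ico_subset_Icc_self hs)).hasDerivWithinAt) 1 (by simp)
  simp only [one_smul, zero_smul, add_zero] at h
  rw [← h]
  exact hC y (Metric.ball_subset_closedBall hy.2)

variable {g : Fin d → Space d → ℝ} {F : Fin d → Fin d → Space d → ℝ}

/-- Being a primitive is a local property, by a smooth partition of unity. -/
theorem IsPrimitiveOn.of_iUnion (hg : ∀ k, MemLp (g k) 2) (hF : ∀ k l, MemLp (F k l) 2)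
    {ι : Type*} [Finite ι] {U : ι → Set (Space d)} (hU : ∀ i, IsOpen (U i)) {q : Space d → ℝ}
    (hint : ∀ i ψ, IsTestFunction (U i) ψ → Integrable fun x => q x * ψ x)
    (hq : ∀ i, IsPrimitiveOn (U i) q g F) : IsPrimitiveOn (⋃ i, U i) q g F := by
  intro k ψ hψ
  have := Fintype.ofFinite ι
  obtain ⟨f, hf⟩ := SmoothPartitionOfUnity.exists_isSubordinate 𝓘(ℝ, Space d)
    (isClosed_tsupport ψ) U hU hψ.3
  have hψi : ∀ i, IsTestFunction (U i) fun x => f i x * ψ x := fun i =>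
    ⟨((f i).contMDiff.contDiff).mul hψ.1, hψ.2.mul_left,
      (tsupport_mul_subset_left).trans (hf i)⟩
  have hsum : ψ = fun x => ∑ i, f i x * ψ x := by
    ext x
    rw [← Finset.sum_mul]
    by_cases hx : x ∈ tsupport ψ
    · have := f.sum_eq_one hx
      rw [finsum_eq_sum_of_fintype] at this
      rw [this, one_mul]
    · rw [image_eq_zero_of_notMem_tsupport hx, mul_zero]
  have hpd : pderiv k ψ = fun x => ∑ i, pderiv k (fun x => f i x * ψ x) x := by
    ext x
    conv_lhs => rw [hsum]
    unfold pderiv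
    rw [fderiv_fun_sum fun i _ => (hψi i).1.differentiable (by simp) x, sum_apply]
  have hdiv : divFunctional (g k) (F k) ψ =
      ∑ i, divFunctional (g k) (F k) fun x => f i x * ψ x := by
    conv_lhs => rw [hsum]
    exact divFunctional_sum (hg k) (hF k) _ (fun i => (hψi i).1) (fun i => (hψi i).2)
  rw [hdiv, hpd, ← Finset.sum_neg_distrib]
  simp only [Finset.mul_sum]
  rw [integral_finsetSum _ fun i _ => hint i _ ((hψi i).pderiv k)]
  exact Finset.sum_congr rfl fun i _ => hq i k _ (hψi i)

theorem mul_ae_eq_mul_of_tsupport_subset {U : Set (Space d)} {f f' ψ : Space d → ℝ}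
    (hae : ∀ᵐ x, x ∈ U → f x = f' x) (hψ : tsupport ψ ⊆ U) :
    (fun x => f x * ψ x) =ᵐ[volume] fun x => f' x * ψ x := by
  filter_upwards [hae] with x hx
  by_cases h : x ∈ tsupport ψ
  · rw [hx (hψ h)]
  · simp [image_eq_zero_of_notMem_tsupport h]

/-- Gluing of local primitives: on overlaps two of them differ by a locally constant function, and
these differences form a coboundary since `Ω` is simply connected. The corrections stay square
integrable because a locally constant function on a patch is bounded on a smaller one. -/
theorem exists_primitive_of_patches {Ω : Set (Space d)} (hΩ : IsOpen Ω) [SimplyConnectedSpace Ω]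
    (hg : ∀ k, MemLp (g k) 2) (hF : ∀ k l, MemLp (F k l) 2)
    {ι : Type*} [Finite ι] {x v : ι → Space d} {R r ρ : ι → ℝ}
    (hp : ∀ i, IsPatch Ω (x i) (R i) (r i) (v i) (ρ i))
    (hcov : Ω ⊆ ⋃ i, Metric.ball (x i) (r i)) {q : ι → Space d → ℝ}
    (hq : ∀ i, MemLp (q i) 2) (hq' : ∀ i, Integrable (q i))
    (hqp : ∀ i, IsPrimitiveOn (Ω ∩ Metric.ball (x i) (R i)) (q i) g F) :
    ∃ Q : Space d → ℝ, MemLp Q 2 (volume.restrict Ω) ∧ IsPrimitiveOn Ω Q g F := by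
  set U : ι → Set (Space d) := fun i => Ω ∩ Metric.ball (x i) (R i) with hUdef
  set V : ι → Set (Space d) := fun i => Ω ∩ Metric.ball (x i) (r i) with hVdef
  have hU : ∀ i, IsOpen (U i) := fun i => hΩ.inter Metric.isOpen_ball
  have hV : ∀ i, IsOpen (V i) := fun i => hΩ.inter Metric.isOpen_ball
  have hVU : ∀ i, V i ⊆ U i := fun i =>
    Set.inter_subset_inter_right _ (Metric.ball_subset_ball (hp i).radius_le)
  have hVcov : ⋃ i, V i = Ω := by
    rw [← Set.inter_iUnion]
    exact Set.inter_eq_left.2 hcov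
  have hdiff : ∀ i j, ∃ c : Space d → ℝ, (∀ y ∈ U i ∩ U j, ∀ᶠ z in 𝓝 y, c z = c y) ∧
      ∀ᵐ y, y ∈ U i ∩ U j → q i y - q j y = c y := fun i j => by
    refine exists_locallyConstant_of_integral_pderiv_eq_zero ((hU i).inter (hU j))
      ((hq' i).sub (hq' j)) fun k ψ hψ => ?_
    have hψk := hψ.pderiv k
    simp only [sub_mul]
    rw [integral_sub (integrable_mul_of_memLp (hq i) hψk.1 hψk.2)
      (integrable_mul_of_memLp (hq j) hψk.1 hψk.2),
      hqp i k ψ ⟨hψ.1, hψ.2, hψ.3.trans Set.inter_subset_left⟩,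
      hqp j k ψ ⟨hψ.1, hψ.2, hψ.3.trans Set.inter_subset_right⟩, sub_self]
  choose c hc hcae using hdiff
  obtain ⟨b, hb, hbc⟩ := exists_coboundary_of_isOpen hΩ hU (fun i => Set.inter_subset_left)
    (hVcov.symm.subset.trans (Set.iUnion_mono hVU)) c hc fun i j k y hy => by
      refine eq_of_ae_eq_of_eventually_eq (((hU i).inter (hU j)).inter (hU k))
        (f := fun y => c i j y + c j k y) (fun z hz => ?_) (fun z hz => hc i k z ⟨hz.1.1, hz.2⟩)
        ?_ hy
      · filter_upwards [hc i j z hz.1, hc j k z ⟨hz.1.2, hz.2⟩] with w h1 h2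
        rw [h1, h2]
      · filter_upwards [hcae i j, hcae j k, hcae i k] with z h1 h2 h3 hz
        rw [← h1 hz.1, ← h2 ⟨hz.1.2, hz.2⟩, ← h3 ⟨hz.1.1, hz.2⟩]
        ring
  classical
  let Q : Space d → ℝ := fun y =>
    if hy : ∃ i, y ∈ V i then q hy.choose y + b hy.choose y else 0
  -- The choice of the patch does not matter, up to a null set.
  have hQ : ∀ j, ∀ᵐ y, y ∈ U j → Q y = q j y + b j y := fun j => by
    filter_upwards [ae_all_iff.2 fun i => hcae i j] with y hy hyj
    have hyV : ∃ i, y ∈ V i := by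
      rw [← Set.mem_iUnion, hVcov]
      exact hyj.1
    have hyi := hVU _ hyV.choose_spec
    simp only [Q, dif_pos hyV]
    rw [hbc _ _ y ⟨hyi, hyj⟩, ← hy _ ⟨hyi, hyj⟩]
    ring
  have hbcont : ∀ i, ContinuousOn (b i) (U i) := fun i y hy =>
    (hasFDerivAt_zero_of_eventually_eq (hb i y hy)).continuousAt.continuousWithinAt
  refine ⟨Q, ?_, ?_⟩
  · have hL : ∀ i, MemLp (fun y => q i y + b i y) 2 (volume.restrict (V i)) := fun i => by
      obtain ⟨C, hC⟩ := (hp i).exists_bound (hb i)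
      have : IsFiniteMeasure (volume.restrict (V i)) :=
        ⟨by simpa using (measure_mono Set.inter_subset_right).trans_lt measure_ball_lt_top⟩
      exact ((hq i).restrict _).add (MemLp.of_bound
        (((hbcont i).mono (hVU i)).aestronglyMeasurable (hV i).measurableSet) C
        (ae_restrict_of_forall_mem (hV i).measurableSet hC))
    have hQV : ∀ i, (fun y => q i y + b i y) =ᵐ[volume.restrict (V i)] Q := fun i => by
      rw [EventuallyEq, ae_restrict_iff' (hV i).measurableSet]
      filter_upwards [hQ i] with y hy hyV
      exact (hy (hVU i hyV)).symm
    have := Fintype.ofFinite ι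
    rw [← hVcov]
    have hsum : MemLp (fun y => ∑ i, (V i).indicator (fun y => ‖q i y + b i y‖) y) 2
        (volume.restrict (⋃ i, V i)) := by
      refine (memLp_finsetSum _ fun i _ => ?_ : MemLp _ 2 volume).restrict _
      exact (memLp_indicator_iff_restrict (hV i).measurableSet).2 (hL i).norm
    refine hsum.mono (aestronglyMeasurable_iUnion_iff.2 fun i => ((hL i).ae_eq (hQV i)).1)
      (ae_restrict_of_forall_mem (MeasurableSet.iUnion fun i => (hV i).measurableSet)
        fun y hy => ?_)
    have hy' := Set.mem_iUnion.1 hy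
    simp only [Q, dif_pos hy']
    refine le_trans ?_ (le_abs_self _)
    refine le_trans (le_of_eq ?_) (Finset.single_le_sum
      (f := fun i => (V i).indicator (fun y => ‖q i y + b i y‖) y) (fun i _ =>
        Set.indicator_nonneg (fun _ _ => norm_nonneg _) _) (Finset.mem_univ hy'.choose))
    rw [Set.indicator_of_mem hy'.choose_spec]
  · have hint : ∀ i ψ, IsTestFunction (V i) ψ →
        Integrable (fun x => q i x * ψ x) ∧ Integrable fun x => b i x * ψ x := fun i ψ hψ =>
      ⟨integrable_mul_of_memLp (hq i) hψ.1 hψ.2, integrable_mul_of_tsupport_subset (hU i)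
        (hbcont i) hψ.1.continuous hψ.2 (hψ.3.trans (hVU i))⟩
    have hQψ : ∀ i ψ, IsTestFunction (V i) ψ → (fun x => Q x * ψ x) =ᵐ[volume]
        fun x => q i x * ψ x + b i x * ψ x := fun i ψ hψ => by
      simpa only [add_mul] using
        mul_ae_eq_mul_of_tsupport_subset (hQ i) (hψ.3.trans (hVU i))
    rw [← hVcov]
    refine IsPrimitiveOn.of_iUnion hg hF hV (fun i ψ hψ => ?_) fun i k ψ hψ => ?_
    · exact ((hint i ψ hψ).1.add (hint i ψ hψ).2).congr (hQψ i ψ hψ).symm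
    · have hψk := hψ.pderiv k
      have hψU : IsTestFunction (U i) ψ := ⟨hψ.1, hψ.2, hψ.3.trans (hVU i)⟩
      rw [integral_congr_ae (hQψ i _ hψk), integral_add (hint i _ hψk).1 (hint i _ hψk).2,
        hqp i k ψ hψU, integral_mul_pderiv_eq (hU i) (f' := fun _ => 0)
          (fun y hy => hasFDerivAt_zero_of_eventually_eq (hb i y hy)) continuousOn_const hψU]
      simp

theorem IsPatch.exists_primitive {Ω : Set (Space d)} (hg : ∀ k, MemLp (g k) 2)
    (hg' : ∀ k, Integrable (g k)) (hF : ∀ k l, MemLp (F k l) 2) (hF' : ∀ k l, Integrable (F k l))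
    (hcl : IsClosedOn Ω g F) {x₀ v : Space d} {R r ρ : ℝ} (hp : IsPatch Ω x₀ R r v ρ) :
    ∃ q : Space d → ℝ, MemLp q 2 ∧ Integrable q ∧
      IsPrimitiveOn (Ω ∩ Metric.ball x₀ r) q g F := by
  obtain ⟨φ, hφ, hφc, hφ1, hφs⟩ := exists_mollifier v hp.width_pos
  obtain ⟨q, hq, hqp⟩ := exists_primitive_of_mollifier hg hg' hF hF' hcl hφ hφc hφ1 hp.radius_pos
    (by
      rintro _ ⟨y, hy, _, ⟨⟨s, z⟩, ⟨hs, hz⟩, rfl⟩, rfl⟩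
      exact (hp.segment_mem y hy s hs z (hφs hz)).1)
    (by
      rintro _ ⟨y, hy, z, hz, rfl⟩
      exact (hp.translate_mem y hy z (hφs hz)).1)
  have : IsFiniteMeasure (volume.restrict (Metric.ball x₀ r)) :=
    ⟨by simpa using measure_ball_lt_top⟩
  refine ⟨(Metric.ball x₀ r).indicator q,
    (memLp_indicator_iff_restrict measurableSet_ball).2 hq,
    (integrable_indicator_iff measurableSet_ball).2 (hq.integrable (by norm_num)),
    fun k ψ hψ => ?_⟩
  rw [← hqp k ψ hψ]
  refine integral_congr_ae (mul_ae_eq_mul_of_tsupport_subset (U := Metric.ball x₀ r)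
    (Eventually.of_forall fun y hy => Set.indicator_of_mem hy _) ?_)
  exact (hψ.pderiv k).3.trans Set.inter_subset_right

/-- On a bounded simply connected Lipschitz domain, a closed family of distributions
`gₖ + ∑ₗ ∂ₗ Fₖₗ` with square integrable `gₖ`, `Fₖₗ` is the gradient of a square integrable
function. -/
theorem exists_primitive {Ω : Set (Space d)} (hΩ : IsOpen Ω) (hbdd : Bornology.IsBounded Ω)
    [SimplyConnectedSpace Ω] (hlip : HasLipschitzBoundary Ω) (hg : ∀ k, MemLp (g k) 2)
    (hg' : ∀ k, Integrable (g k)) (hF : ∀ k l, MemLp (F k l) 2) (hF' : ∀ k l, Integrable (F k l))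
    (hcl : IsClosedOn Ω g F) :
    ∃ q : Space d → ℝ, MemLp q 2 (volume.restrict Ω) ∧ IsPrimitiveOn Ω q g F := by
  -- Two nested patches at each point: primitives live on the larger one, and the smaller one
  -- controls the locally constant corrections.
  have h : ∀ x : closure Ω, ∃ R r v ρ, ∃ q : Space d → ℝ, IsPatch Ω x R r v ρ ∧ MemLp q 2 ∧
      Integrable q ∧ IsPrimitiveOn (Ω ∩ Metric.ball (x : Space d) R) q g F := fun x => by
    obtain ⟨R, v, ρ, hp⟩ := exists_isPatch hΩ hlip x.2 one_pos
    obtain ⟨q, hq⟩ := hp.exists_primitive hg hg' hF hF' hcl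
    obtain ⟨r, v', ρ', hp'⟩ := exists_isPatch hΩ hlip x.2 hp.radius_pos
    exact ⟨R, r, v', ρ', q, hp', hq⟩
  choose R r v ρ q hp hq hq' hqp using h
  obtain ⟨t, ht⟩ := hbdd.isCompact_closure.elim_nhds_subcover'
    (fun x hx => Metric.ball x (r ⟨x, hx⟩))
    fun x hx => Metric.ball_mem_nhds _ (hp ⟨x, hx⟩).radius_pos
  refine exists_primitive_of_patches hΩ hg hF (ι := t) (fun i => hp i) ?_ (fun i => hq i)
    (fun i => hq' i) (fun i => hqp i)
  intro y hy
  obtain ⟨x, hxt, hyx⟩ := Set.mem_iUnion₂.1 (ht (subset_closure hy))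
  exact Set.mem_iUnion.2 ⟨⟨x, hxt⟩, hyx⟩

end PoincareLemma

/-! ### Distributional derivatives tested by integrals -/

section Distribution

open scoped ContDiff

variable {d : ℕ} {Ω : Opens (EuclideanSpace ℝ (Fin d))}

theorem isTestFunction_coe (ψ : 𝓓(Ω, ℝ)) : IsTestFunction (Ω : Set (Space d)) ψ :=
  ⟨ψ.contDiff, ψ.hasCompactSupport, ψ.tsupport_subset⟩

theorem IsTestFunction.exists_coe_eq {ψ : Space d → ℝ} (hψ : IsTestFunction (Ω : Set (Space d)) ψ) :
    ∃ χ : 𝓓(Ω, ℝ), ⇑χ = ψ :=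
  ⟨⟨ψ, hψ.1, hψ.2, hψ.3⟩, rfl⟩

theorem coe_lineDerivOp_single (ψ : 𝓓(Ω, ℝ)) (i : Fin d) :
    ⇑(∂_{EuclideanSpace.single i (1 : ℝ)} ψ : 𝓓(Ω, ℝ)) = pderiv i ψ := by
  ext x
  rw [TestFunction.lineDerivOp_eq_lineDerivCLM (𝕜 := ℝ),
    TestFunction.lineDerivCLM_apply_of_le (by simp)]
  exact (((isTestFunction_coe ψ).1.differentiable (by simp)) x).lineDeriv_eq_fderiv

theorem partialDeriv_apply (i : Fin d) (T : 𝓓'(Ω, ℝ)) (ψ : 𝓓(Ω, ℝ)) :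
    partialDeriv i T ψ = - T (∂_{EuclideanSpace.single i (1 : ℝ)} ψ) := by
  rw [partialDeriv, Distribution.lineDerivOp_apply_apply, map_neg]

theorem partialDeriv_comm (i j : Fin d) (T : 𝓓'(Ω, ℝ)) :
    partialDeriv i (partialDeriv j T) = partialDeriv j (partialDeriv i T) := by
  ext ψ
  simp only [partialDeriv_apply, neg_neg]
  congr 1
  ext x
  rw [coe_lineDerivOp_single, coe_lineDerivOp_single, coe_lineDerivOp_single,
    coe_lineDerivOp_single, pderiv_comm (isTestFunction_coe ψ).1]

theorem toDistribution_apply {f : Space d → ℝ}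
    (hf : LocallyIntegrableOn f (Ω : Set (Space d))) (ψ : 𝓓(Ω, ℝ)) :
    toDistribution Ω f ψ = ∫ x, f x * ψ x := by
  refine (TestFunction.integralAgainstBilinCLM_eq_integral hf).trans ?_
  simp [mul_comm]

theorem partialDeriv_toDistribution_apply {f : Space d → ℝ}
    (hf : LocallyIntegrableOn f (Ω : Set (Space d))) (i : Fin d) (ψ : 𝓓(Ω, ℝ)) :
    partialDeriv i (toDistribution Ω f) ψ = - ∫ x, f x * pderiv i ψ x := by
  rw [partialDeriv_apply, toDistribution_apply hf, coe_lineDerivOp_single]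

theorem partialDeriv_partialDeriv_toDistribution_apply {f : Space d → ℝ}
    (hf : LocallyIntegrableOn f (Ω : Set (Space d))) (i j : Fin d) (ψ : 𝓓(Ω, ℝ)) :
    partialDeriv i (partialDeriv j (toDistribution Ω f)) ψ =
      ∫ x, f x * pderiv i (pderiv j ψ) x := by
  rw [partialDeriv_apply, partialDeriv_toDistribution_apply hf, coe_lineDerivOp_single, neg_neg,
    pderiv_comm (isTestFunction_coe ψ).1]

theorem locallyIntegrableOn_of_memLp (hbdd : Bornology.IsBounded (Ω : Set (Space d)))
    {f : Space d → ℝ} (hf : MemLp f 2 (volume.restrict (Ω : Set (Space d)))) :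
    LocallyIntegrableOn f (Ω : Set (Space d)) := by
  have : IsFiniteMeasure (volume.restrict (Ω : Set (Space d))) :=
    ⟨by simpa using hbdd.measure_lt_top⟩
  have : IntegrableOn f (Ω : Set (Space d)) := hf.integrable (by norm_num)
  exact this.locallyIntegrableOn

theorem integral_indicator_mul {U : Set (Space d)} {f ψ : Space d → ℝ} (hψ : tsupport ψ ⊆ U) :
    ∫ x, U.indicator f x * ψ x = ∫ x, f x * ψ x :=
  integral_congr_ae (mul_ae_eq_mul_of_tsupport_subset
    (Filter.Eventually.of_forall fun _ hy => Set.indicator_of_mem hy _) hψ)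

theorem integrable_mul_testFunction_of_locallyIntegrableOn {f : Space d → ℝ}
    (hf : LocallyIntegrableOn f (Ω : Set (Space d))) (ψ : 𝓓(Ω, ℝ)) :
    Integrable fun x => f x * ψ x := by
  have := ψ.integrable_bilin (ContinuousLinearMap.mul ℝ ℝ) hf
  simpa [mul_comm] using this

/-- A symmetrised gradient satisfies the compatibility conditions since partial derivatives of
distributions commute. -/
theorem opC2_eq_zero_of_isSymGradient {w : Space d → Space d}
    {A : Space d → Matrix (Fin d) (Fin d) ℝ} (h : IsSymGradient Ω w A) (i j s t : Fin d) :
    opC2 Ω A i j s t = 0 := by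
  obtain ⟨G, hG, hA⟩ := h
  have key : ∀ i j, toDistribution Ω (fun x => A x i j) = (1 / 2 : ℝ) •
      (partialDeriv j (toDistribution Ω fun x => w x i) +
        partialDeriv i (toDistribution Ω fun x => w x j)) := fun i j => by
    have hae : ∀ᵐ x, x ∈ (Ω : Set (Space d)) → (1 / 2 : ℝ) * (G x i j + G x j i) = A x i j := by
      rw [ae_restrict_iff' Ω.isOpen.measurableSet] at hA
      filter_upwards [hA] with x hx hxΩ
      simp [hx hxΩ]
    have hint : LocallyIntegrableOn (fun x => A x i j) (Ω : Set (Space d)) :=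
      (((hG i j).2.1.add (hG j i).2.1).smul (1 / 2 : ℝ)).congr
        ((ae_restrict_iff' Ω.isOpen.measurableSet).2 hae)
    rw [(hG i j).2.2, (hG j i).2.2]
    ext ψ
    change toDistribution Ω (fun x => A x i j) ψ = (1 / 2 : ℝ) *
      (toDistribution Ω (fun x => G x i j) ψ + toDistribution Ω (fun x => G x j i) ψ)
    rw [toDistribution_apply hint, toDistribution_apply (hG i j).2.1,
      toDistribution_apply (hG j i).2.1, ← integral_add
        (integrable_mul_testFunction_of_locallyIntegrableOn (hG i j).2.1 ψ)
        (integrable_mul_testFunction_of_locallyIntegrableOn (hG j i).2.1 ψ), ← integral_const_mul]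
    refine (integral_congr_ae ((mul_ae_eq_mul_of_tsupport_subset hae
      ψ.tsupport_subset).symm.trans (Filter.Eventually.of_forall fun x => ?_)))
    ring
  have hadd : ∀ (i : Fin d) (T S : 𝓓'(Ω, ℝ)),
      partialDeriv i (T + S) = partialDeriv i T + partialDeriv i S := fun i T S =>
    LineDeriv.lineDerivOp_add _ T S
  have hsmul : ∀ (i : Fin d) (c : ℝ) (T : 𝓓'(Ω, ℝ)),
      partialDeriv i (c • T) = c • partialDeriv i T := fun i c T =>
    LineDeriv.lineDerivOp_smul _ c T
  have hrot : ∀ (i s j : Fin d) (T : 𝓓'(Ω, ℝ)), partialDeriv i (partialDeriv s (partialDeriv j T)) =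
      partialDeriv j (partialDeriv s (partialDeriv i T)) := fun i s j T => by
    rw [partialDeriv_comm s j, partialDeriv_comm i j, partialDeriv_comm s i]
  unfold opC2
  simp only [key, hadd, hsmul]
  rw [hrot i s j, hrot j t i, partialDeriv_comm s t (toDistribution Ω fun x => w x j),
    partialDeriv_comm t s (toDistribution Ω fun x => w x i)]
  module

end Distribution

/-! ### The displacement field of a compatible strain -/

section Reconstruction

open scoped ContDiff
open Filter

variable {d : ℕ} {Ω : Opens (EuclideanSpace ℝ (Fin d))}

/-- The skew-symmetric part `q` of the displacement gradient: for fixed `i`, `j`, the compatibility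
conditions say that the distributions `∂ⱼ aᵢₖ - ∂ᵢ aⱼₖ` form a curl-free field, so they are the
partial derivatives of some `qᵢⱼ`, which can be taken skew-symmetric in `i`, `j`. -/
theorem exists_rotation {Ω : Set (Space d)} (hΩ : IsOpen Ω) (hbdd : Bornology.IsBounded Ω)
    [SimplyConnectedSpace Ω] (hlip : HasLipschitzBoundary Ω) {a : Fin d → Fin d → Space d → ℝ}
    (ha : ∀ i j, MemLp (a i j) 2) (ha' : ∀ i j, Integrable (a i j))
    (hcompat : ∀ i j s t χ, IsTestFunction Ω χ →
      (∫ x, a j t x * pderiv i (pderiv s χ) x) + (∫ x, a i s x * pderiv j (pderiv t χ) x)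
        - (∫ x, a j s x * pderiv i (pderiv t χ) x) - (∫ x, a i t x * pderiv j (pderiv s χ) x) = 0) :
    ∃ q : Fin d → Fin d → Space d → ℝ, (∀ i j, MemLp (q i j) 2 (volume.restrict Ω)) ∧
      (∀ i j x, q j i x = - q i j x) ∧ ∀ i j k ψ, IsTestFunction Ω ψ →
        ∫ x, q i j x * pderiv k ψ x =
          (∫ x, a i k x * pderiv j ψ x) - ∫ x, a j k x * pderiv i ψ x := by
  classical
  -- `∂ⱼ aᵢₖ - ∂ᵢ aⱼₖ` in the form `∑ₗ ∂ₗ Fₗ`, with `Fₗ = δₗⱼ aᵢₖ - δₗᵢ aⱼₖ`.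
  let F : Fin d → Fin d → Fin d → Fin d → Space d → ℝ := fun i j k l x =>
    (if l = j then a i k x else 0) - if l = i then a j k x else 0
  have hite : ∀ (p : Prop) [Decidable p] (i k : Fin d),
      MemLp (fun x => if p then a i k x else 0) 2 ∧
        Integrable fun x => if p then a i k x else 0 := fun p _ i k => by
    split_ifs
    · exact ⟨ha i k, ha' i k⟩
    · exact ⟨MemLp.zero, integrable_zero _ _ _⟩
  have hdiv : ∀ i j k ψ, ContDiff ℝ ∞ ψ → HasCompactSupport ψ →
      divFunctional (fun _ => 0) (F i j k) ψ =
        (∫ x, a j k x * pderiv i ψ x) - ∫ x, a i k x * pderiv j ψ x := fun i j k ψ hψ hψc => by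
    have hl : ∀ l, ∫ x, F i j k l x * pderiv l ψ x =
        (if l = j then ∫ x, a i k x * pderiv l ψ x else 0) -
          if l = i then ∫ x, a j k x * pderiv l ψ x else 0 := fun l => by
      simp only [F, sub_mul]
      rw [integral_sub
        (integrable_mul_of_memLp (hite _ i k).1 (contDiff_pderiv hψ l)
          (hasCompactSupport_pderiv hψc l))
        (integrable_mul_of_memLp (hite _ j k).1 (contDiff_pderiv hψ l)
          (hasCompactSupport_pderiv hψc l))]
      congr 1 <;> split_ifs <;> simp
    simp [divFunctional, hl, Finset.sum_sub_distrib]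
  have h : ∀ i j, ∃ q : Space d → ℝ, MemLp q 2 (volume.restrict Ω) ∧
      IsPrimitiveOn Ω q (fun _ _ => 0) (F i j) := fun i j => by
    refine exists_primitive hΩ hbdd hlip (fun _ => MemLp.zero) (fun _ => integrable_zero _ _ _)
      (fun k l => (hite _ i k).1.sub (hite _ j k).1) (fun k l => (hite _ i k).2.sub (hite _ j k).2)
      fun k m χ hχ => ?_
    rw [hdiv i j m _ (hχ.pderiv k).1 (hχ.pderiv k).2, hdiv i j k _ (hχ.pderiv m).1 (hχ.pderiv m).2]
    linarith [hcompat i j k m χ hχ]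
  choose q hq hqp using h
  -- The prescribed gradient is skew-symmetric in `i`, `j`, so the potential may be antisymmetrised.
  refine ⟨fun i j x => (1 / 2 : ℝ) * (q i j x - q j i x), fun i j =>
    ((hq i j).sub (hq j i)).const_mul _, fun i j x => by ring, fun i j k ψ hψ => ?_⟩
  have hψk := hψ.pderiv k
  have hint : ∀ i j, Integrable fun x => q i j x * pderiv k ψ x := fun i j => by
    have h1 := integrable_mul_of_memLp
      ((memLp_indicator_iff_restrict hΩ.measurableSet).2 (hq i j)) hψk.1 hψk.2
    exact h1.congr (mul_ae_eq_mul_of_tsupport_subset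
      (Eventually.of_forall fun y hy => Set.indicator_of_mem hy _) hψk.3)
  simp only [mul_assoc, sub_mul]
  rw [integral_const_mul, integral_sub (hint i j) (hint j i), hqp i j k ψ hψ, hqp j i k ψ hψ,
    hdiv i j k ψ hψ.1 hψ.2, hdiv j i k ψ hψ.1 hψ.2]
  ring

/-- The displacement: the identities `∂ₖ qᵢⱼ = ∂ⱼ aᵢₖ - ∂ᵢ aⱼₖ` and the symmetry of `a` make the
rows of `a + q` curl-free, so these are gradients. -/
theorem exists_displacement {Ω : Set (Space d)} (hΩ : IsOpen Ω) (hbdd : Bornology.IsBounded Ω)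
    [SimplyConnectedSpace Ω] (hlip : HasLipschitzBoundary Ω) {a : Fin d → Fin d → Space d → ℝ}
    (ha : ∀ i j, MemLp (a i j) 2) (ha' : ∀ i j, Integrable (a i j))
    (hsymm : ∀ i j, a i j =ᵐ[volume] a j i) {q : Fin d → Fin d → Space d → ℝ}
    (hq : ∀ i j, MemLp (q i j) 2) (hq' : ∀ i j, Integrable (q i j))
    (hqp : ∀ i j k ψ, IsTestFunction Ω ψ → ∫ x, q i j x * pderiv k ψ x =
      (∫ x, a i k x * pderiv j ψ x) - ∫ x, a j k x * pderiv i ψ x) :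
    ∃ w : Fin d → Space d → ℝ, (∀ i, MemLp (w i) 2 (volume.restrict Ω)) ∧
      ∀ i j ψ, IsTestFunction Ω ψ →
        ∫ x, w i x * pderiv j ψ x = - ∫ x, (a i j x + q i j x) * ψ x := by
  have hdiv : ∀ i k ψ, divFunctional (fun x => a i k x + q i k x) (fun _ _ => (0 : ℝ)) ψ =
      ∫ x, (a i k x + q i k x) * ψ x := fun i k ψ => by simp [divFunctional]
  have h : ∀ i, ∃ w : Space d → ℝ, MemLp w 2 (volume.restrict Ω) ∧
      IsPrimitiveOn Ω w (fun k x => a i k x + q i k x) (fun _ _ _ => 0) := fun i => by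
    refine exists_primitive hΩ hbdd hlip (fun k => (ha i k).add (hq i k))
      (fun k => (ha' i k).add (hq' i k)) (fun _ _ => MemLp.zero)
      (fun _ _ => integrable_zero _ _ _) fun k m χ hχ => ?_
    rw [hdiv, hdiv]
    simp only [add_mul]
    rw [integral_add
        (integrable_mul_of_memLp (ha i m) (hχ.pderiv k).1 (hχ.pderiv k).2)
        (integrable_mul_of_memLp (hq i m) (hχ.pderiv k).1 (hχ.pderiv k).2),
      integral_add
        (integrable_mul_of_memLp (ha i k) (hχ.pderiv m).1 (hχ.pderiv m).2)
        (integrable_mul_of_memLp (hq i k) (hχ.pderiv m).1 (hχ.pderiv m).2),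
      hqp i m k χ hχ, hqp i k m χ hχ]
    have : ∫ x, a m k x * pderiv i χ x = ∫ x, a k m x * pderiv i χ x :=
      integral_congr_ae ((hsymm m k).mul EventuallyEq.rfl)
    rw [this]
    ring
  choose w hw hwp using h
  exact ⟨w, hw, fun i j ψ hψ => by rw [hwp i j ψ hψ, hdiv]⟩

/-- Saint-Venant's theorem: a square integrable symmetric matrix field satisfying the
compatibility conditions is a symmetrised gradient. -/
theorem exists_memH1_isSymGradient (hbdd : Bornology.IsBounded (Ω : Set (Space d)))
    [SimplyConnectedSpace (Ω : Set (Space d))] (hlip : HasLipschitzBoundary (Ω : Set (Space d)))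
    {A : Space d → Matrix (Fin d) (Fin d) ℝ} (hA : MemL2Matrix Ω A)
    (hsymm : ∀ᵐ x ∂(volume.restrict (Ω : Set (Space d))), (A x).IsSymm)
    (hC : ∀ i j s t, opC2 Ω A i j s t = 0) :
    ∃ w : Space d → Space d, MemH1 Ω w ∧ IsSymGradient Ω w A := by
  have hmeas : MeasurableSet (Ω : Set (Space d)) := Ω.isOpen.measurableSet
  have : IsFiniteMeasure (volume.restrict (Ω : Set (Space d))) :=
    ⟨by simpa using hbdd.measure_lt_top⟩
  have hext : ∀ f : Space d → ℝ, MemLp f 2 (volume.restrict (Ω : Set (Space d))) →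
      MemLp ((Ω : Set (Space d)).indicator f) 2 ∧
        Integrable ((Ω : Set (Space d)).indicator f) := fun f hf =>
    ⟨(memLp_indicator_iff_restrict hmeas).2 hf,
      (integrable_indicator_iff hmeas).2 (hf.integrable (by norm_num))⟩
  have hloc := fun i j => locallyIntegrableOn_of_memLp hbdd (hA i j)
  let a : Fin d → Fin d → Space d → ℝ := fun i j =>
    (Ω : Set (Space d)).indicator fun x => A x i j
  have ha : ∀ i j, MemLp (a i j) 2 ∧ Integrable (a i j) := fun i j => hext _ (hA i j)
  obtain ⟨q, hq, hqskew, hqp⟩ := exists_rotation Ω.isOpen hbdd hlip (fun i j => (ha i j).1)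
    (fun i j => (ha i j).2) fun i j s t χ hχ => by
      obtain ⟨ψ, rfl⟩ := hχ.exists_coe_eq
      have h1 := DFunLike.congr_fun (hC i j s t) ψ
      have h2 : ∀ i j k l, ∫ x, a i j x * pderiv k (pderiv l ψ) x =
          partialDeriv k (partialDeriv l (toDistribution Ω fun x => A x i j)) ψ :=
        fun i j k l => by
          rw [partialDeriv_partialDeriv_toDistribution_apply (hloc i j)]
          exact integral_indicator_mul ((hχ.pderiv l).pderiv k).3
      rw [h2, h2, h2, h2]
      exact h1
  obtain ⟨w, hw, hwp⟩ := exists_displacement Ω.isOpen hbdd hlip (fun i j => (ha i j).1)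
    (fun i j => (ha i j).2)
    (fun i j => by
      rw [ae_restrict_iff' hmeas] at hsymm
      filter_upwards [hsymm] with x hx
      by_cases hxΩ : x ∈ (Ω : Set (Space d))
      · simp only [a, Set.indicator_of_mem hxΩ]
        exact (hx hxΩ).apply j i
      · simp only [a, Set.indicator_of_notMem hxΩ])
    (q := fun i j => (Ω : Set (Space d)).indicator (q i j))
    (fun i j => (hext _ (hq i j)).1) (fun i j => (hext _ (hq i j)).2)
    fun i j k ψ hψ => by rw [integral_indicator_mul (hψ.pderiv k).3, hqp i j k ψ hψ]
  let W : Space d → Space d := fun x => WithLp.toLp 2 fun i => w i x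
  let G : Space d → Matrix (Fin d) (Fin d) ℝ := fun x => Matrix.of fun i j => A x i j + q i j x
  have hG : ∀ i j, MemLp (fun x => G x i j) 2 (volume.restrict (Ω : Set (Space d))) := fun i j =>
    (hA i j).add (hq i j)
  have hWG : HasWeakGradient Ω W G := fun i j => by
    have hwl := locallyIntegrableOn_of_memLp hbdd (hw i)
    have hGl := locallyIntegrableOn_of_memLp hbdd (hG i j)
    refine ⟨hwl, hGl, ?_⟩
    ext ψ
    have hψ := isTestFunction_coe ψ
    rw [toDistribution_apply hGl]
    refine (partialDeriv_toDistribution_apply hwl j ψ).trans ?_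
    rw [hwp i j ψ hψ, neg_neg]
    refine integral_congr_ae (mul_ae_eq_mul_of_tsupport_subset
      (Eventually.of_forall fun x hx => ?_) hψ.3)
    simp only [a, G, Set.indicator_of_mem hx, Matrix.of_apply]
  refine ⟨W, ⟨memLp_piLp_iff.2 hw, G, hWG, hG⟩, G, hWG, ?_⟩
  filter_upwards [hsymm] with x hx
  ext i j
  have h1 := hx.apply i j
  have h2 := hqskew i j x
  simp only [G, Matrix.smul_apply, Matrix.add_apply, Matrix.transpose_apply, Matrix.of_apply,
    smul_eq_mul]
  linarith

end Reconstruction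

end SaintVenant

end

theorem mainTheorem8 (d : ℕ) (Ω : Opens (EuclideanSpace ℝ (Fin d)))
    (hbdd : Bornology.IsBounded (Ω : Set (EuclideanSpace ℝ (Fin d))))
    (hcontr : ContractibleSpace (Ω : Set (EuclideanSpace ℝ (Fin d))))
    (hlip : SaintVenant.HasLipschitzBoundary (Ω : Set (EuclideanSpace ℝ (Fin d))))
    (A : EuclideanSpace ℝ (Fin d) → Matrix (Fin d) (Fin d) ℝ)
    (hA : SaintVenant.MemL2Matrix Ω A)
    (hsymm : ∀ᵐ x ∂(volume.restrict (Ω : Set (EuclideanSpace ℝ (Fin d)))), (A x).IsSymm) :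
    (∃ w : EuclideanSpace ℝ (Fin d) → EuclideanSpace ℝ (Fin d),
      SaintVenant.MemH1 Ω w ∧ SaintVenant.IsSymGradient Ω w A) ↔
    (∀ i j s t : Fin d, SaintVenant.opC2 Ω A i j s t = 0) := by
  have := SimplyConnectedSpace.ofContractible (Ω : Set (EuclideanSpace ℝ (Fin d)))
  exact ⟨fun ⟨_, _, hw⟩ => SaintVenant.opC2_eq_zero_of_isSymGradient hw,
    SaintVenant.exists_memH1_isSymGradient hbdd hlip hA hsymm⟩
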